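/- Let $N,m\ge 1$ be integers, let $\mathcal H=\mathcal H_1\oplus\cdots\oplus\mathcal H_m$ be the Hilbert direct sum of separable real Hilbert spaces, with norm $\|\cdot\|$ and Borel $\sigma$-algebra, and write $x=(x_1,\dots,x_m)$ for $x\in\mathcal H$. Let $F_i:\mathcal H\to\mathcal H$, $i\in[N]:=\{1,\dots,N\}$, be nonexpansive with block components $F_i(x)=(F_{i1}(x),\dots,F_{im}(x))$, let $F:=\frac1N\sum_{i=1}^N F_i$, and suppose that $\mathrm{Fix}(F):=\{x\in\mathcal H:F(x)=x\}$ is nonempty. Assume: (1) There is $B>0$ such that $\|F_i(x)-x\|\le B$ for all $i\in[N]$ and $x\in\mathcal H$. (2) $\mathcal G_k=([N],\mathcal E_k)$, $k\in\mathbb N=\{0,1,2,\dots\}$, are digraphs, and $A_k=(a_{ij,k})\in\mathbb R^{N\times N}$ satisfy $a_{ij,k}>0$ if $(j,i)\in\mathcal E_k$ and $a_{ij,k}=0$ otherwise. There is an integer $Q>0$ such that for every $k\ge 0$ the union graph $([N],\bigcup_{l=1}^{Q}\mathcal E_{k+l})$ is strongly connected. For all $k$, all row and column sums of $A_k$ equal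 $1$. There is a constant $\underline a\in(0,1)$ such that $a_{ij,k}>\underline a$ whenever $a_{ij,k}>0$, and $a_{ii,k}>\underline a$ for all $i,k$. (3) The stepsizes $(\alpha_k)_{k\in\mathbb N}$ are nonincreasing with $\alpha_k\in(0,1]$, $\sum_{k\ge1}\alpha_k=\infty$ and $\sum_{k\ge1}\alpha_k\alpha_{\lfloor k/2\rfloor}<\infty$. On a probability space $(\Omega,\mathcal F,\mathbb P)$ let $x_{i,0}$, $i\in[N]$, be $\mathcal H$-valued random variables, and let $x_{i,k}=(x_{i1,k},\dots,x_{im,k})$ be generated by the D-BKM iteration $$\hat x_{i,k}=\sum_{j=1}^N a_{ij,k}x_{j,k},\qquad x_{il,k+1}=\hat x_{il,k}+b_{l,k}\,\alpha_k\big(F_{il}(\hat x_{i,k})-\hat x_{il,k}\big),\quad i\in[N],\ l\in[m],\ k\in\mathbb N.$$ Here, for each $l\in[m]$, $(b_{l,k})_{k\in\mathbb N}$ are i.i.d. $\{0,1\}$-valued random variables with $p_l:=\mathbb P(b_{l,0}=1)>0$, and for each $l$ and $k$ the variable $b_{l,k}$ is independent of the $\sigma$-algebra generated by $x_{i,s}$,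 $i\in[N]$, $0\le s\le k$. The joint law of the $b_{l,k}$ over different $l$ is arbitrary; in particular this covers the scheme in which one block $q\in[m]$ is drawn at each time $k$, with $b_{q,k}=1$ and $b_{l,k}=0$ for $l\ne q$. Let $\langle\langle y,z\rangle\rangle:=\sum_{l=1}^m\frac1{p_l}\langle y_l,z_l\rangle$ and $|||y|||^2:=\langle\langle y,y\rangle\rangle$. Then, almost surely, all $x_{i,k}$ ($i\in[N]$, $k\in\mathbb N$) are bounded, in $\|\cdot\|$ and in $|||\cdot|||$, and converge weakly in $(\mathcal H,|||\cdot|||)$, as $k\to\infty$, to a common point of $\mathrm{Fix}(F)$: there is a (random) $x\in\mathrm{Fix}(F)$ with $\lim_{k\to\infty}\langle\langle x_{i,k},u\rangle\rangle=\langle\langle x,u\rangle\rangle$ for all $u\in\mathcal H$ and all $i\in[N]$. -/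

import Mathlib

open MeasureTheory ProbabilityTheory Filter Topology

noncomputable section

namespace DBKM

/-! ### Communication graphs and weights -/

/-- Every node has a directed path to every other node. -/
def StronglyConnected {V : Type*} (G : Digraph V) : Prop :=
  ∀ u v : V, u ≠ v → Relation.TransGen G.Adj u v

/-- There is `Q > 0` such that for every `k` the union of the graphs at the times
`k + 1, …, k + Q` is strongly connected. -/
def UniformlyJointlyStronglyConnected {V : Type*} (G : ℕ → Digraph V) : Prop :=
  ∃ Q : ℕ, 0 < Q ∧ ∀ k : ℕ, StronglyConnected (⨆ l ∈ Finset.Icc 1 Q, G (k + l))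

/-- `A k` is a weighted adjacency matrix of `G k`: the entry `(i, j)` is positive if there is an
edge from `j` to `i` (information flows from `j` to `i`), and it is zero otherwise. -/
def IsAdjacency {N : ℕ} (G : ℕ → Digraph (Fin N)) (A : ℕ → Matrix (Fin N) (Fin N) ℝ) : Prop :=
  ∀ k i j, ((G k).Adj j i → 0 < A k i j) ∧ (¬ (G k).Adj j i → A k i j = 0)

/-- All row and column sums are one, and the positive entries and all diagonal entries are
bounded below by a common constant in `(0, 1)`. -/
structure WeightsRule {N : ℕ} (A : ℕ → Matrix (Fin N) (Fin N) ℝ) : Prop where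
  row_sum : ∀ k i, ∑ j, A k i j = 1
  col_sum : ∀ k j, ∑ i, A k i j = 1
  lower_bound : ∃ a : ℝ, 0 < a ∧ a < 1 ∧
    (∀ k i j, 0 < A k i j → a < A k i j) ∧ (∀ k i, a < A k i i)

/-! ### Stepsizes -/

/-- Nonincreasing stepsizes in `(0, 1]` with `∑_{k ≥ 1} α k = ∞` and
`∑_{k ≥ 1} α k * α ⌊k / 2⌋ < ∞` (the division `k / 2` is that of `ℕ`). -/
structure Stepsizes (α : ℕ → ℝ) : Prop where
  antitone : Antitone α
  pos : ∀ k, 0 < α k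
  le_one : ∀ k, α k ≤ 1
  sum_eq_top : Tendsto (fun n : ℕ => ∑ k ∈ Finset.Icc 1 n, α k) atTop atTop
  summable : Summable fun k : ℕ => α (k + 1) * α ((k + 1) / 2)

/-! ### Operators, on an arbitrary real normed space -/

/-- The global operator `x ↦ (1 / N) ∑ i, F i x`. -/
def globalOp {N : ℕ} {E : Type*} [NormedAddCommGroup E] [NormedSpace ℝ E]
    (F : Fin N → E → E) (x : E) : E :=
  (1 / (N : ℝ)) • ∑ i, F i x

/-- The displacements `F i x - x` are bounded, uniformly in the agent `i` and the point `x`. -/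
def BoundedDisplacement {N : ℕ} {E : Type*} [NormedAddCommGroup E] (F : Fin N → E → E) : Prop :=
  ∃ B : ℝ, 0 < B ∧ ∀ i x, ‖F i x - x‖ ≤ B

/-! ### The block-coordinate iteration on `H 1 ⊕ ⋯ ⊕ H m` -/

section Iteration

variable {N m : ℕ} {H : Fin m → Type*} [∀ l, NormedAddCommGroup (H l)]
  [∀ l, InnerProductSpace ℝ (H l)]

/-- The aggregate message `∑ j, a i j * x j` received by agent `i`. -/
def aggregate (A : Matrix (Fin N) (Fin N) ℝ) (x : Fin N → PiLp 2 H) (i : Fin N) : PiLp 2 H :=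
  ∑ j, A i j • x j

/-- The processes `X i k` (agent `i`, time `k`) obey the block-coordinate iteration: the block `l`
of agent `i` moves by `b l k * α k * (F i (x̂ i k) - x̂ i k) l` from the aggregate `x̂ i k`. -/
def IsIteration {Ω : Type*} (A : ℕ → Matrix (Fin N) (Fin N) ℝ) (α : ℕ → ℝ)
    (b : Fin m → ℕ → Ω → ℝ) (F : Fin N → PiLp 2 H → PiLp 2 H)
    (X : Fin N → ℕ → Ω → PiLp 2 H) : Prop :=
  ∀ (i : Fin N) (k : ℕ) (l : Fin m) (ω : Ω),
    X i (k + 1) ω l = aggregate (A k) (fun j => X j k ω) i l +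
      (b l k ω * α k) • (F i (aggregate (A k) (fun j => X j k ω) i) l -
        aggregate (A k) (fun j => X j k ω) i l)

/-- The σ-algebra generated by all `X i s` with `i` any agent and `s ≤ k`. -/
abbrev history {Ω E : Type*} [MeasurableSpace E] (X : Fin N → ℕ → Ω → E) (k : ℕ) :
    MeasurableSpace Ω :=
  ⨆ (i : Fin N) (s : ℕ) (_ : s ≤ k), MeasurableSpace.comap (X i s) inferInstance

/-- The probability `p l` that block `l` is activated. -/
def blockProb {Ω : Type*} [MeasurableSpace Ω] (μ : Measure Ω) (b : Fin m → ℕ → Ω → ℝ)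
    (l : Fin m) : ℝ :=
  μ.real {ω | b l 0 ω = 1}

/-- The random block activations: for each block `l` the variables `b l 0, b l 1, …` are
`{0, 1}`-valued, independent and identically distributed, `b l k` is independent of the history
of the iterates up to time `k`, and `b l 0 = 1` has positive probability. Nothing is required of
the joint law over different blocks; in particular, exactly one block may be drawn at each time. -/
structure IsBlockSelection {Ω E : Type*} [MeasurableSpace Ω] [MeasurableSpace E] (μ : Measure Ω)
    (b : Fin m → ℕ → Ω → ℝ) (X : Fin N → ℕ → Ω → E) : Prop where
  measurable : ∀ l k, Measurable (b l k)
  zero_or_one : ∀ l k ω, b l k ω = 0 ∨ b l k ω = 1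
  indep_time : ∀ l, iIndepFun (b l) μ
  identDistrib : ∀ l k, IdentDistrib (b l k) (b l 0) μ μ
  indep_history : ∀ l k, Indep (MeasurableSpace.comap (b l k) inferInstance) (history X k) μ
  prob_pos : ∀ l, 0 < blockProb μ b l

/-! ### The weighted Hilbert space structure -/

/-- The weighted inner product `∑ l, (1 / p l) * ⟪y l, z l⟫`. -/
def weightedInner (p : Fin m → ℝ) (y z : PiLp 2 H) : ℝ :=
  ∑ l, 1 / p l * inner ℝ (y l) (z l)

/-- The weighted norm: its square is `∑ l, (1 / p l) * ‖y l‖ ^ 2`. -/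
def weightedNorm (p : Fin m → ℝ) (y : PiLp 2 H) : ℝ :=
  √(weightedInner p y y)

/-- Weak convergence of a sequence with respect to the weighted inner product. -/
def WeightedWeakTendsto (p : Fin m → ℝ) (y : ℕ → PiLp 2 H) (z : PiLp 2 H) : Prop :=
  ∀ u : PiLp 2 H, Tendsto (fun k => weightedInner p (y k) u) atTop (𝓝 (weightedInner p z u))

end Iteration

end DBKM

end

/-!
Write `x̄` for the average of the agents' states (`mean`) and `T` for the global operator.

*Consensus.* Joint strong connectivity and the lower bound on the weights make every product of
sufficiently many consecutive weight matrices entrywise at least some `η > 0`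
(`exists_transition_lower_bound`). On vectors of mean zero such a doubly stochastic matrix acts like
the nonnegative matrix with `η` subtracted from all entries, so it contracts the total distance of
the agents from their average, `disagreement`, by `1 - N * η`. Since each step perturbs the states
by `O(α k)`, the disagreements are square-summable, with a bound that depends only on the initial
disagreement (`exists_sum_disagreement_sq_le`).

*Energy.* Column sums equal to one make `x̄` an inexact block-coordinate Krasnoselskii-Mann iteration
of `T`, with error at most the disagreement. In the weighted inner product the factor `1 / p l`
cancels the activation probability of block `l`, so the expected energy `|||x̄ - z|||²` relative to a
fixed point `z` decreases by `α * ‖T x̄ - x̄‖²` up to summable errors. The energy change is a sum over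
blocks, which is why the joint law of the blocks is irrelevant. The Robbins-Siegmund theorem
(`ae_tendsto_and_summable_of_almost_supermartingale`) then yields convergence of the energy and
`∑ α * ‖T x̄ - x̄‖² < ∞` (`ae_energy_tendsto`). The initial states need not be integrable, so this is
done on the events that they are bounded by `R`; these exhaust `Ω`.

*Weak limits.* As `‖T x̄ - x̄‖` changes by `O(α k)` per step and `∑ α = ∞`, it tends to zero
(`tendsto_zero_of_summable_mul_sq`), so every weak cluster point of `x̄` is fixed by `T`. Energies
relative to a countable dense set of fixed points converge simultaneously, and this separates any
two weak cluster points (`exists_fixedPt_weak_limit`). The agents share the weak limit of `x̄`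
because the disagreement vanishes.
-/

namespace DBKM

/-! ### Mixing of the weight matrices -/

lemma exists_crossing_of_transGen {V : Type*} {r : V → V → Prop} {s : Set V} {u v : V}
    (h : Relation.TransGen r u v) (hu : u ∈ s) (hv : v ∉ s) :
    ∃ x ∈ s, ∃ y ∉ s, r x y := by
  induction h with
  | single h => exact ⟨u, hu, _, hv, h⟩
  | @tail w y _ h ih =>
    by_cases hw : w ∈ s
    · exact ⟨w, hw, y, hv, h⟩
    · exact ih hw

/-- The product `A (k + t - 1) * ⋯ * A k` of `t` consecutive matrices, which transports the states
at time `k` to time `k + t`. -/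
noncomputable def transition {N : ℕ} (A : ℕ → Matrix (Fin N) (Fin N) ℝ) (k : ℕ) :
    ℕ → Matrix (Fin N) (Fin N) ℝ
  | 0 => 1
  | t + 1 => A (k + t) * transition A k t

section Mixing

variable {N : ℕ} {G : ℕ → Digraph (Fin N)} {A : ℕ → Matrix (Fin N) (Fin N) ℝ}

lemma IsAdjacency.nonneg (hA : IsAdjacency G A) (k : ℕ) (i j : Fin N) : 0 ≤ A k i j := by
  by_cases h : (G k).Adj j i
  · exact ((hA k i j).1 h).le
  · exact ((hA k i j).2 h).ge

lemma mem_doublyStochastic_of_weightsRule (hA : IsAdjacency G A) (hW : WeightsRule A) (k : ℕ) :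
    A k ∈ doublyStochastic ℝ (Fin N) :=
  mem_doublyStochastic_iff_sum.2 ⟨hA.nonneg k, hW.row_sum k, hW.col_sum k⟩

lemma transition_mem_doublyStochastic (hA : IsAdjacency G A) (hW : WeightsRule A) (k t : ℕ) :
    transition A k t ∈ doublyStochastic ℝ (Fin N) := by
  induction t with
  | zero => exact one_mem _
  | succ t ih => exact mul_mem (mem_doublyStochastic_of_weightsRule hA hW _) ih

/-- The entries `≥ a ^ t` of the `t`-step transition matrix propagate along the entries `≥ a` of
the next weight matrix. -/
lemma pow_le_transition_succ (hA : IsAdjacency G A) (hW : WeightsRule A) {a : ℝ} (ha : 0 < a)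
    {k t : ℕ} {i i' j : Fin N} (h : a ^ t ≤ transition A k t i j) (hi : a ≤ A (k + t) i' i) :
    a ^ (t + 1) ≤ transition A k (t + 1) i' j := by
  rw [transition, Matrix.mul_apply, pow_succ']
  calc a * a ^ t ≤ A (k + t) i' i * transition A k t i j := by gcongr; exact hA.nonneg ..
    _ ≤ _ := Finset.single_le_sum (f := fun x => A (k + t) i' x * transition A k t x j)
        (fun x _ => mul_nonneg (hA.nonneg ..)
          (nonneg_of_mem_doublyStochastic (transition_mem_doublyStochastic hA hW k t)))
        (Finset.mem_univ i)

lemma pow_le_transition_mono (hA : IsAdjacency G A) (hW : WeightsRule A) {a : ℝ} (ha : 0 < a)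
    (hd : ∀ k i, a < A k i i) {k t t' : ℕ} (htt : t ≤ t') {i j : Fin N}
    (h : a ^ t ≤ transition A k t i j) : a ^ t' ≤ transition A k t' i j := by
  induction htt with
  | refl => exact h
  | step _ ih => exact pow_le_transition_succ hA hW ha ih (hd _ _).le

/-- The set of nodes that node `j` influences with weight `≥ a ^ t` never loses a node, and
every `Q + 1` steps it gains one until it is full. -/
lemma exists_transition_lower_bound (hA : IsAdjacency G A)
    (hG : UniformlyJointlyStronglyConnected G) (hW : WeightsRule A) :
    ∃ L : ℕ, ∃ η : ℝ, 0 < η ∧ ∀ k i j, η ≤ transition A k L i j := by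
  obtain ⟨Q, -, hQ⟩ := hG
  obtain ⟨a, ha, -, hedge, hdiag⟩ := hW.lower_bound
  refine ⟨N * (Q + 1), a ^ (N * (Q + 1)), by positivity, fun k i j => ?_⟩
  let R : ℕ → Finset (Fin N) := fun t => {i | a ^ t ≤ transition A k t i j}
  have hR : ∀ {t t'}, t ≤ t' → R t ⊆ R t' := fun htt i hi => by
    simp only [R, Finset.mem_filter, Finset.mem_univ, true_and] at hi ⊢
    exact pow_le_transition_mono hA hW ha hdiag htt hi
  have hj : ∀ t, j ∈ R t := fun t => hR (Nat.zero_le t) (by simp [R, transition])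
  have hgrow : ∀ t, R t ≠ Finset.univ → (R t).card < (R (t + (Q + 1))).card := by
    intro t ht
    obtain ⟨v, hv⟩ : ∃ v, v ∉ R t := by
      by_contra! h
      exact ht (Finset.eq_univ_iff_forall.2 h)
    have hjv : j ≠ v := fun h => hv (h ▸ hj t)
    -- The edges at the times `k + t + 1, …, k + t + Q` include one that leaves `R t`.
    obtain ⟨x, hx, y, hy, hxy⟩ :=
      exists_crossing_of_transGen (s := (R t : Set (Fin N))) (hQ (k + t) j v hjv)
        (by simpa using hj t) (by simpa using hv)
    simp only [Digraph.iSup_adj] at hxy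
    obtain ⟨l, hl, hxy⟩ := hxy
    rw [Finset.mem_Icc] at hl
    have hxl : x ∈ R (t + l) := hR (t.le_add_right l) (by simpa using hx)
    have hyl : y ∈ R (t + l + 1) := by
      simp only [R, Finset.mem_filter, Finset.mem_univ, true_and] at hxl ⊢
      refine pow_le_transition_succ hA hW ha hxl (hedge _ _ _ ?_).le
      rw [← add_assoc]
      exact (hA _ y x).1 hxy
    exact Finset.card_lt_card ((Finset.ssubset_iff_of_subset (hR (by omega))).2
      ⟨y, hR (by omega) hyl, by simpa using hy⟩)
  have hcard : ∀ n, n ≤ N → n ≤ (R (n * (Q + 1))).card := by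
    intro n
    induction n with
    | zero => simp
    | succ n ih =>
      intro hn
      specialize ih (by omega)
      by_cases h : R (n * (Q + 1)) = Finset.univ
      · have : R ((n + 1) * (Q + 1)) = Finset.univ :=
          Finset.eq_univ_of_forall fun i =>
            hR (Nat.mul_le_mul_right _ n.le_succ) (h ▸ Finset.mem_univ i)
        rw [this, Finset.card_univ, Fintype.card_fin]
        exact hn
      · have := hgrow _ h
        rw [Nat.succ_mul]
        omega
  have huniv : R (N * (Q + 1)) = Finset.univ := by
    rw [← Finset.card_eq_iff_eq_univ, Fintype.card_fin]
    exact le_antisymm (by simpa using Finset.card_le_univ (R (N * (Q + 1)))) (hcard N le_rfl)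
  have : i ∈ R (N * (Q + 1)) := huniv ▸ Finset.mem_univ i
  simpa [R] using this

end Mixing

/-! ### Disagreement -/

section Disagreement

variable {N : ℕ} {E : Type*} [NormedAddCommGroup E] [NormedSpace ℝ E]

/-- The average of the states of all agents. -/
noncomputable def mean (v : Fin N → E) : E := (1 / (N : ℝ)) • ∑ i, v i

/-- The total distance of the agents from their average. -/
noncomputable def disagreement (v : Fin N → E) : ℝ := ∑ i, ‖v i - mean v‖

lemma disagreement_nonneg (v : Fin N → E) : 0 ≤ disagreement v :=
  Finset.sum_nonneg fun _ _ => norm_nonneg _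

lemma mean_add (v w : Fin N → E) : mean (v + w) = mean v + mean w := by
  simp [mean, Finset.sum_add_distrib]

lemma disagreement_add_le (v w : Fin N → E) :
    disagreement (v + w) ≤ disagreement v + disagreement w := by
  rw [disagreement, disagreement, disagreement, ← Finset.sum_add_distrib]
  refine Finset.sum_le_sum fun i _ => ?_
  rw [mean_add, Pi.add_apply, add_sub_add_comm]
  exact norm_add_le _ _

lemma norm_mean_le {v : Fin N → E} {c : ℝ} (hN : 0 < N) (h : ∀ i, ‖v i‖ ≤ c) : ‖mean v‖ ≤ c := by
  have hN' : (0 : ℝ) < N := by exact_mod_cast hN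
  rw [mean, norm_smul, Real.norm_of_nonneg (by positivity)]
  calc 1 / (N : ℝ) * ‖∑ i, v i‖ ≤ 1 / (N : ℝ) * ∑ _i : Fin N, c := by
        gcongr
        exact (norm_sum_le _ _).trans (Finset.sum_le_sum fun i _ => h i)
    _ = c := by simp; field_simp

lemma disagreement_le_of_norm_le {v : Fin N → E} {c : ℝ} (hN : 0 < N) (h : ∀ i, ‖v i‖ ≤ c) :
    disagreement v ≤ 2 * N * c := by
  calc disagreement v ≤ ∑ _i : Fin N, (c + c) := by
        refine Finset.sum_le_sum fun i _ => ?_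
        exact (norm_sub_le _ _).trans (add_le_add (h i) (norm_mean_le hN h))
    _ = 2 * N * c := by simp; ring

lemma sum_sub_mean (hN : 0 < N) (v : Fin N → E) : ∑ i, (v i - mean v) = 0 := by
  have hN' : (N : ℝ) ≠ 0 := by exact_mod_cast hN.ne'
  simp [mean, Finset.sum_sub_distrib, ← Nat.cast_smul_eq_nsmul ℝ, smul_smul, hN']

lemma mean_mul {M : Matrix (Fin N) (Fin N) ℝ} (hM : M ∈ doublyStochastic ℝ (Fin N))
    (v : Fin N → E) : mean (fun i => ∑ j, M i j • v j) = mean v := by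
  rw [mean, mean, Finset.sum_comm]
  simp [← Finset.sum_smul, sum_col_of_mem_doublyStochastic hM]

/-- Subtracting the constant `η` from all entries of `M` does not change its action on vectors
of mean zero, and leaves a nonnegative matrix with column sums `1 - N * η`. -/
lemma disagreement_mul_le (hN : 0 < N) {M : Matrix (Fin N) (Fin N) ℝ}
    (hM : M ∈ doublyStochastic ℝ (Fin N)) {η : ℝ} (hη : ∀ i j, η ≤ M i j) (v : Fin N → E) :
    disagreement (fun i => ∑ j, M i j • v j) ≤ (1 - N * η) * disagreement v := by
  have h1 : ∀ i, ∑ j, M i j • v j - mean v = ∑ j, (M i j - η) • (v j - mean v) := by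
    intro i
    simp only [sub_smul _ η, Finset.sum_sub_distrib (fun j => M i j • (v j - mean v)),
      ← Finset.smul_sum, sum_sub_mean hN v, smul_zero, sub_zero]
    simp only [smul_sub, Finset.sum_sub_distrib, ← Finset.sum_smul,
      sum_row_of_mem_doublyStochastic hM, one_smul]
  calc disagreement (fun i => ∑ j, M i j • v j)
      = ∑ i, ‖∑ j, (M i j - η) • (v j - mean v)‖ := by
        simp only [disagreement, mean_mul hM, h1]
    _ ≤ ∑ i, ∑ j, (M i j - η) * ‖v j - mean v‖ := by
        refine Finset.sum_le_sum fun i _ => (norm_sum_le _ _).trans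
          (Finset.sum_le_sum fun j _ => ?_)
        rw [norm_smul, Real.norm_of_nonneg (sub_nonneg.2 (hη i j))]
    _ = (1 - N * η) * disagreement v := by
        rw [Finset.sum_comm, disagreement, Finset.mul_sum]
        refine Finset.sum_congr rfl fun j _ => ?_
        rw [← Finset.sum_mul, Finset.sum_sub_distrib, sum_col_of_mem_doublyStochastic hM]
        simp

lemma norm_sum_smul_le {M : Matrix (Fin N) (Fin N) ℝ} (hM : M ∈ doublyStochastic ℝ (Fin N))
    {v : Fin N → E} {c : ℝ} (h : ∀ i, ‖v i‖ ≤ c) (i : Fin N) : ‖∑ j, M i j • v j‖ ≤ c := by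
  calc ‖∑ j, M i j • v j‖ ≤ ∑ j, M i j * c := by
        refine (norm_sum_le _ _).trans (Finset.sum_le_sum fun j _ => ?_)
        have := nonneg_of_mem_doublyStochastic hM (i := i) (j := j)
        rw [norm_smul, Real.norm_of_nonneg this]
        exact mul_le_mul_of_nonneg_left (h j) this
    _ = c := by rw [← Finset.sum_mul, sum_row_of_mem_doublyStochastic hM, one_mul]

end Disagreement

/-! ### Square-summability of the disagreement -/

section Consensus

variable {N : ℕ} {G : ℕ → Digraph (Fin N)} {A : ℕ → Matrix (Fin N) (Fin N) ℝ}
  {E : Type*} [NormedAddCommGroup E] [NormedSpace ℝ E]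

/-- Over `t` steps, a perturbed consensus iteration deviates from the unperturbed one by at most
the sum of the perturbations. -/
lemma norm_sub_transition_le (hA : IsAdjacency G A) (hW : WeightsRule A) {α : ℕ → ℝ}
    (hα : Antitone α) {c : ℝ} (hc : 0 ≤ c) {x : ℕ → Fin N → E}
    (hx : ∀ k i, ‖x (k + 1) i - ∑ j, A k i j • x k j‖ ≤ c * α k) (k t : ℕ) (i : Fin N) :
    ‖x (k + t) i - ∑ j, transition A k t i j • x k j‖ ≤ t * (c * α k) := by
  induction t generalizing i with
  | zero => simp [transition, Matrix.one_apply, ite_smul]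
  | succ t ih =>
    have h1 : x (k + (t + 1)) i - ∑ j, transition A k (t + 1) i j • x k j =
        (x (k + t + 1) i - ∑ j, A (k + t) i j • x (k + t) j) +
        ∑ j, A (k + t) i j • (x (k + t) j - ∑ j', transition A k t j j' • x k j') := by
      simp only [transition, Matrix.mul_apply, Finset.sum_smul, smul_sub, Finset.sum_sub_distrib,
        Finset.smul_sum, smul_smul, ← add_assoc]
      rw [Finset.sum_comm]
      abel
    rw [h1]
    refine (norm_add_le _ _).trans ?_
    have h2 := norm_sum_smul_le (mem_doublyStochastic_of_weightsRule hA hW (k + t)) ih i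
    have h3 := hx (k + t) i
    have h4 : c * α (k + t) ≤ c * α k := mul_le_mul_of_nonneg_left (hα (by omega)) hc
    push_cast
    linarith

/-- `D (k + L) ≤ ρ * D k + e k` with `ρ < 1` bounds the partial sums of `D ^ 2` by those of
`e ^ 2`. -/
lemma sum_sq_le_of_contraction {D e : ℕ → ℝ} {ρ : ℝ} (hρ0 : 0 ≤ ρ) (hρ : ρ < 1)
    (hD : ∀ k, 0 ≤ D k) {L : ℕ} (h : ∀ k, D (k + L) ≤ ρ * D k + e k) (n : ℕ) :
    ∑ k ∈ Finset.range n, D k ^ 2 ≤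
      (∑ k ∈ Finset.range L, D k ^ 2) / (1 - ρ) +
        (∑ k ∈ Finset.range n, e k ^ 2) / (1 - ρ) ^ 2 := by
  have hρ' : 0 < 1 - ρ := by linarith
  have h1 : ∀ k, D (k + L) ^ 2 ≤ ρ * D k ^ 2 + e k ^ 2 / (1 - ρ) := by
    intro k
    have h2 : D (k + L) ^ 2 ≤ (ρ * D k + e k) ^ 2 := pow_le_pow_left₀ (hD _) (h k) 2
    -- Convexity of the square: `ρ * D + e = ρ * D + (1 - ρ) * (e / (1 - ρ))`.
    have h3 : ρ * D k ^ 2 + e k ^ 2 / (1 - ρ) - (ρ * D k + e k) ^ 2 =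
        ρ * (1 - ρ) * (D k - e k / (1 - ρ)) ^ 2 := by
      field_simp
      ring
    have h4 : 0 ≤ ρ * (1 - ρ) * (D k - e k / (1 - ρ)) ^ 2 := by positivity
    linarith
  have h2 : ∑ k ∈ Finset.range n, D k ^ 2 ≤
      ∑ k ∈ Finset.range L, D k ^ 2 + ∑ k ∈ Finset.range n, D (k + L) ^ 2 := by
    calc ∑ k ∈ Finset.range n, D k ^ 2 ≤ ∑ k ∈ Finset.range (L + n), D k ^ 2 :=
          Finset.sum_le_sum_of_subset_of_nonneg (Finset.range_mono (by omega))
            fun _ _ _ => sq_nonneg _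
      _ = _ := by
          rw [Finset.sum_range_add]
          simp only [add_comm]
  have h3 : ∑ k ∈ Finset.range n, D (k + L) ^ 2 ≤
      ρ * ∑ k ∈ Finset.range n, D k ^ 2 + (∑ k ∈ Finset.range n, e k ^ 2) / (1 - ρ) := by
    rw [Finset.mul_sum, Finset.sum_div, ← Finset.sum_add_distrib]
    exact Finset.sum_le_sum fun k _ => h1 k
  have h4 : (∑ k ∈ Finset.range n, D k ^ 2) * (1 - ρ) ≤
      ∑ k ∈ Finset.range L, D k ^ 2 + (∑ k ∈ Finset.range n, e k ^ 2) / (1 - ρ) := by linarith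
  rw [← le_div_iff₀ hρ'] at h4
  refine h4.trans (le_of_eq ?_)
  field_simp

/-- Under perturbations of size `c * α k` the disagreement is square-summable, with a bound that
depends on the initial states only through their disagreement. -/
theorem exists_sum_disagreement_sq_le (hN : 0 < N) (hA : IsAdjacency G A)
    (hG : UniformlyJointlyStronglyConnected G) (hW : WeightsRule A) {α : ℕ → ℝ}
    (hα : Antitone α) (hα2 : Summable fun k => α k ^ 2)
    {c : ℝ} (hc : 0 ≤ c) (M : ℝ) :
    ∃ K : ℝ, ∀ x : ℕ → Fin N → E,
      (∀ k i, ‖x (k + 1) i - ∑ j, A k i j • x k j‖ ≤ c * α k) → disagreement (x 0) ≤ M →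
      ∀ n, ∑ k ∈ Finset.range n, disagreement (x k) ^ 2 ≤ K := by
  obtain ⟨L, η, hη, hL⟩ := exists_transition_lower_bound hA hG hW
  have hN' : (0 : ℝ) < N := by exact_mod_cast hN
  let ρ : ℝ := 1 - N * η
  have hρ : ρ < 1 := by simp only [ρ]; nlinarith
  -- A row of the transition matrix has sum one and `N` entries `≥ η`.
  have hρ0 : 0 ≤ ρ := by
    have h1 := sum_row_of_mem_doublyStochastic (transition_mem_doublyStochastic hA hW 0 L) ⟨0, hN⟩
    have h2 : ∑ _j : Fin N, η ≤ ∑ j, transition A 0 L ⟨0, hN⟩ j :=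
      Finset.sum_le_sum fun j _ => hL _ _ _
    simp only [Finset.sum_const, Finset.card_univ, Fintype.card_fin, nsmul_eq_mul] at h2
    simp only [ρ]
    linarith
  let c' : ℝ := 2 * N * (L * c)
  refine ⟨(∑ k ∈ Finset.range L, (M + 2 * N * (k * (c * α 0))) ^ 2) / (1 - ρ) +
    (c' ^ 2 * ∑' k, α k ^ 2) / (1 - ρ) ^ 2, fun x hx hM n => ?_⟩
  have hstep : ∀ k t : ℕ, ∀ θ : ℝ, (∀ i j, θ ≤ transition A k t i j) →
      disagreement (x (k + t)) ≤
        (1 - N * θ) * disagreement (x k) + 2 * N * (t * (c * α k)) := by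
    intro k t θ hθ
    have h1 := disagreement_mul_le hN (transition_mem_doublyStochastic hA hW k t) hθ (x k)
    have h2 := disagreement_le_of_norm_le hN
      (v := fun i => x (k + t) i - ∑ j, transition A k t i j • x k j)
      (norm_sub_transition_le hA hW hα hc hx k t)
    have h3 := disagreement_add_le (fun i => ∑ j, transition A k t i j • x k j)
      (fun i => x (k + t) i - ∑ j, transition A k t i j • x k j)
    have h4 : ((fun i => ∑ j, transition A k t i j • x k j) +
      fun i => x (k + t) i - ∑ j, transition A k t i j • x k j) = x (k + t) := by
      ext i; simp
    rw [h4] at h3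
    linarith
  have hmain := sum_sq_le_of_contraction (D := fun k => disagreement (x k))
    (e := fun k => c' * α k) hρ0 hρ (fun k => disagreement_nonneg _) (L := L)
    (fun k => (hstep k L η (hL k)).trans_eq (by simp only [ρ, c']; ring)) n
  refine hmain.trans ?_
  gcongr with k _
  · exact disagreement_nonneg _
  · have h1 := hstep 0 k 0 (fun i j =>
      nonneg_of_mem_doublyStochastic (transition_mem_doublyStochastic hA hW 0 k))
    simp only [zero_add, mul_zero, sub_zero, one_mul] at h1
    linarith
  · simp only [mul_pow]
    rw [← Finset.mul_sum]
    gcongr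
    exact hα2.sum_le_tsum _ fun _ _ => sq_nonneg _

end Consensus

/-! ### Convergence of almost decreasing sequences and processes -/

lemma exists_tendsto_of_le_add {u ε : ℕ → ℝ} (hu : ∀ k, 0 ≤ u k) (hε : Summable ε)
    (h : ∀ k, u (k + 1) ≤ u k + ε k) : ∃ l, Tendsto u atTop (𝓝 l) := by
  have hsum := hε.hasSum.tendsto_sum_nat
  let v : ℕ → ℝ := fun k => u k - ∑ j ∈ Finset.range k, ε j
  have hv : Antitone v := antitone_nat_of_succ_le fun k => by
    simp only [v, Finset.sum_range_succ]
    linarith [h k]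
  obtain ⟨C, hC⟩ := hsum.bddAbove_range
  have hbdd : BddBelow (Set.range v) := by
    refine ⟨-C, ?_⟩
    rintro _ ⟨k, rfl⟩
    have := hC ⟨k, rfl⟩
    simp only [v]
    linarith [hu k]
  have := (tendsto_atTop_ciInf hv hbdd).add hsum
  exact ⟨_, this.congr fun k => by simp [v]⟩

/-- The cubes `r ^ 3` grow by at most `3 * c * α * r ^ 2` up to terms of order `α ^ 2`, so they
converge, and the divergence of `∑ α` leaves zero as the only possible limit. -/
lemma tendsto_zero_of_summable_mul_sq {r α : ℕ → ℝ} {c C : ℝ} (hr0 : ∀ k, 0 ≤ r k)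
    (hrC : ∀ k, r k ≤ C) (hα0 : ∀ k, 0 ≤ α k) (hα1 : ∀ k, α k ≤ 1)
    (hα2 : Summable fun k => α k ^ 2)
    (hα : Tendsto (fun n : ℕ => ∑ k ∈ Finset.Icc 1 n, α k) atTop atTop) (hc : 0 ≤ c)
    (hr : ∀ k, r (k + 1) ≤ r k + c * α k) (hs : Summable fun k => α k * r k ^ 2) :
    Tendsto r atTop (𝓝 0) := by
  have h3 : ∀ k, r (k + 1) ^ 3 ≤
      r k ^ 3 + (3 * c * (α k * r k ^ 2) + (3 * c ^ 2 * C + c ^ 3) * α k ^ 2) := by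
    intro k
    have h1 : r (k + 1) ^ 3 ≤ (r k + c * α k) ^ 3 := pow_le_pow_left₀ (hr0 _) (hr k) 3
    have h2 : c ^ 2 * α k ^ 2 * r k ≤ c ^ 2 * α k ^ 2 * C :=
      mul_le_mul_of_nonneg_left (hrC k) (by positivity)
    have h4 : c ^ 3 * α k ^ 2 * α k ≤ c ^ 3 * α k ^ 2 * 1 :=
      mul_le_mul_of_nonneg_left (hα1 k) (by positivity)
    nlinarith
  obtain ⟨l, hl⟩ := exists_tendsto_of_le_add (fun k => pow_nonneg (hr0 k) 3)
    ((hs.mul_left (3 * c)).add (hα2.mul_left (3 * c ^ 2 * C + c ^ 3))) h3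
  have hl0 : 0 ≤ l := ge_of_tendsto' hl fun k => pow_nonneg (hr0 k) 3
  rcases hl0.eq_or_lt with rfl | hlpos
  · have := hl.rpow_const (p := (1 / 3 : ℝ)) (Or.inr (by norm_num))
    rw [Real.zero_rpow (by norm_num)] at this
    refine this.congr fun k => ?_
    rw [← Real.rpow_natCast, ← Real.rpow_mul (hr0 k)]
    norm_num
  · exfalso
    have hC : 0 < C + 1 := by linarith [hr0 0, hrC 0]
    obtain ⟨n₀, hn₀⟩ := eventually_atTop.1 (hl.eventually (lt_mem_nhds (half_lt_self hlpos)))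
    have hle : ∀ k, n₀ ≤ k → α k ≤ 2 * (C + 1) / l * (α k * r k ^ 2) := by
      intro k hk
      have h1 : l / 2 < r k ^ 3 := hn₀ k hk
      have h2 : r k ^ 3 ≤ (C + 1) * r k ^ 2 := by
        nlinarith [hrC k, hr0 k, sq_nonneg (r k)]
      have h5 : 1 ≤ 2 * (C + 1) / l * r k ^ 2 := by
        rw [div_mul_eq_mul_div, le_div_iff₀ hlpos]
        linarith
      nlinarith [hα0 k]
    have hsα : Summable α := by
      rw [← summable_nat_add_iff n₀]
      refine Summable.of_nonneg_of_le (fun k => hα0 _) (fun k => hle (k + n₀) (by omega)) ?_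
      exact (summable_nat_add_iff n₀).2 (hs.mul_left (2 * (C + 1) / l))
    obtain ⟨n, hn⟩ := (hα.eventually (eventually_gt_atTop (∑' k, α k))).exists
    exact absurd (hsα.sum_le_tsum (Finset.Icc 1 n) fun k _ => hα0 k) (not_le.2 hn)

/-- The Robbins-Siegmund theorem, localized to an event `A` known at time zero: on `A`, a
nonnegative process with `𝔼[V (k + 1) | ℱ k] ≤ (1 + β k) * V k - U k + γ k` converges and `∑ U` is
finite. The conditional inequality is stated through integrals over the events of `ℱ k` inside
`A`. -/
theorem ae_tendsto_and_summable_of_almost_supermartingale {Ω : Type*} {m0 : MeasurableSpace Ω}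
    {μ : Measure Ω} [IsFiniteMeasure μ] (ℱ : Filtration ℕ m0) {V U γ : ℕ → Ω → ℝ} {β : ℕ → ℝ}
    {A : Set Ω} (hA : MeasurableSet[ℱ 0] A)
    (hV : ∀ k, Measurable[ℱ k] (V k)) (hU : ∀ k, Measurable[ℱ k] (U k))
    (hγ : ∀ k, Measurable[ℱ k] (γ k))
    (hV0 : ∀ k ω, 0 ≤ V k ω) (hU0 : ∀ k ω, 0 ≤ U k ω) (hγ0 : ∀ k ω, 0 ≤ γ k ω)
    (hVb : ∀ k, ∃ C, ∀ ω ∈ A, V k ω ≤ C) (hUb : ∀ k, ∃ C, ∀ ω ∈ A, U k ω ≤ C)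
    (hγb : ∃ K, ∀ ω ∈ A, ∀ n, ∑ k ∈ Finset.range n, γ k ω ≤ K)
    (hβ0 : ∀ k, 0 ≤ β k) (hβ : Summable β)
    (h : ∀ k s, MeasurableSet[ℱ k] s → s ⊆ A →
      ∫ ω in s, V (k + 1) ω ∂μ ≤ ∫ ω in s, ((1 + β k) * V k ω - U k ω + γ k ω) ∂μ) :
    ∀ᵐ ω ∂μ, ω ∈ A → (∃ l, Tendsto (fun k => V k ω) atTop (𝓝 l)) ∧ Summable fun k => U k ω := by
  obtain ⟨K, hK⟩ := hγb
  -- Integrating factors: `c (k + 1) * (1 + β k) ≤ c k`, and `c` has a positive limit.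
  let c : ℕ → ℝ := fun k => Real.exp (-∑ j ∈ Finset.range k, β j)
  have hc0 : ∀ k, 0 < c k := fun k => Real.exp_pos _
  have hc1 : ∀ k, c k ≤ 1 := fun k => by
    simp only [c, Real.exp_le_one_iff, neg_nonpos]
    exact Finset.sum_nonneg fun j _ => hβ0 j
  have hcβ : ∀ k, c (k + 1) * (1 + β k) ≤ c k := fun k => by
    simp only [c, Finset.sum_range_succ, neg_add, Real.exp_add]
    have h1 : 1 + β k ≤ Real.exp (β k) := by linarith [Real.add_one_le_exp (β k)]
    have h2 : Real.exp (-β k) * (1 + β k) ≤ 1 := by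
      rw [Real.exp_neg, inv_mul_le_iff₀ (Real.exp_pos _)]
      linarith
    have := Real.exp_pos (-∑ j ∈ Finset.range k, β j)
    nlinarith
  have hcl : Tendsto c atTop (𝓝 (Real.exp (-∑' j, β j))) :=
    (Real.continuous_exp.tendsto _).comp hβ.hasSum.tendsto_sum_nat.neg
  have hcinf : ∀ k, Real.exp (-∑' j, β j) ≤ c k := fun k => by
    simp only [c, Real.exp_le_exp, neg_le_neg_iff]
    exact hβ.sum_le_tsum _ fun j _ => hβ0 j
  -- On `A` this is a supermartingale, and the constant `K` makes it nonnegative.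
  let S : ℕ → Ω → ℝ := fun k ω =>
    c k * V k ω + ∑ j ∈ Finset.range k, c (j + 1) * (U j ω - γ j ω) + K
  let Y : ℕ → Ω → ℝ := fun k => A.indicator (S k)
  have hSm : ∀ k, Measurable[ℱ k] (S k) := by
    intro k
    refine Measurable.add_const (Measurable.add (Measurable.const_mul (hV k) _) ?_) _
    refine Finset.measurable_sum _ fun j hj => ?_
    have hjk := ℱ.mono (Finset.mem_range.1 hj).le
    exact (((hU j).mono hjk le_rfl).sub ((hγ j).mono hjk le_rfl)).const_mul _
  have hAk : ∀ k, MeasurableSet[ℱ k] A := fun k => ℱ.mono (Nat.zero_le k) _ hA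
  have hγK : ∀ ω ∈ A, ∀ n, ∑ j ∈ Finset.range n, c (j + 1) * γ j ω ≤ K := fun ω hω n =>
    (Finset.sum_le_sum fun j _ => mul_le_of_le_one_left (hγ0 j ω) (hc1 _)).trans (hK ω hω n)
  have hS0 : ∀ k, ∀ ω ∈ A, 0 ≤ S k ω := by
    intro k ω hω
    have h1 := hγK ω hω k
    have h2 : 0 ≤ ∑ j ∈ Finset.range k, c (j + 1) * U j ω :=
      Finset.sum_nonneg fun j _ => mul_nonneg (hc0 _).le (hU0 _ _)
    have h3 := mul_nonneg (hc0 k).le (hV0 k ω)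
    simp only [S, mul_sub, Finset.sum_sub_distrib]
    linarith
  have hY0 : ∀ k ω, 0 ≤ Y k ω := fun k ω => Set.indicator_nonneg (hS0 k) ω
  have hInt : ∀ {f : Ω → ℝ}, Measurable f → (∀ ω ∈ A, 0 ≤ f ω) → (∃ C, ∀ ω ∈ A, f ω ≤ C) →
      IntegrableOn f A μ := by
    rintro f hf h0 ⟨C, hC⟩
    refine Measure.integrableOn_of_bounded (M := C) (measure_ne_top _ _) hf.aestronglyMeasurable ?_
    refine (ae_restrict_iff' (ℱ.le 0 _ hA)).2 (Eventually.of_forall fun ω hω => ?_)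
    rw [Real.norm_of_nonneg (h0 ω hω)]
    exact hC ω hω
  have hIV : ∀ k, IntegrableOn (V k) A μ := fun k =>
    hInt ((hV k).mono (ℱ.le k) le_rfl) (fun ω _ => hV0 k ω) (hVb k)
  have hIU : ∀ k, IntegrableOn (U k) A μ := fun k =>
    hInt ((hU k).mono (ℱ.le k) le_rfl) (fun ω _ => hU0 k ω) (hUb k)
  have hIγ : ∀ k, IntegrableOn (γ k) A μ := fun k =>
    hInt ((hγ k).mono (ℱ.le k) le_rfl) (fun ω _ => hγ0 k ω) ⟨K, fun ω hω =>
      (Finset.single_le_sum (f := fun j => γ j ω) (fun j _ => hγ0 j ω)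
        (Finset.self_mem_range_succ k)).trans (hK ω hω (k + 1))⟩
  have hIS : ∀ k, IntegrableOn (S k) A μ := by
    intro k
    refine Integrable.add (Integrable.add ((hIV k).const_mul _) ?_) (integrable_const _)
    exact integrable_finsetSum _ fun j _ => ((hIU j).sub (hIγ j)).const_mul _
  have hIY : ∀ k, Integrable (Y k) μ := fun k => (hIS k).integrable_indicator (ℱ.le 0 _ hA)
  have hsuper : Supermartingale Y ℱ μ := by
    refine supermartingale_of_setIntegral_succ_le
      (fun k => ((hSm k).indicator (hAk k)).stronglyMeasurable) hIY fun k s hs => ?_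
    simp only [Y]
    rw [setIntegral_indicator (ℱ.le 0 _ hA), setIntegral_indicator (ℱ.le 0 _ hA)]
    have hsub : s ∩ A ⊆ A := Set.inter_subset_right
    have hst : MeasurableSet[ℱ k] (s ∩ A) := hs.inter (hAk k)
    generalize s ∩ A = t at hsub hst
    have hV1 := (hIV (k + 1)).mono_set hsub
    have hV2 := (hIV k).mono_set hsub
    have hU2 := (hIU k).mono_set hsub
    have hγ2 := (hIγ k).mono_set hsub
    have hS2 := (hIS k).mono_set hsub
    have e1 : ∀ ω, S (k + 1) ω = c (k + 1) * V (k + 1) ω +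
        (S k ω - c k * V k ω + c (k + 1) * (U k ω - γ k ω)) := by
      intro ω
      simp only [S, Finset.sum_range_succ]
      ring
    have hI2 : IntegrableOn
        (fun ω => S k ω - c k * V k ω + c (k + 1) * (U k ω - γ k ω)) t μ :=
      (hS2.sub (hV2.const_mul _)).add ((hU2.sub hγ2).const_mul _)
    have hI3 : IntegrableOn (fun ω => (1 + β k) * V k ω - U k ω + γ k ω) t μ :=
      ((hV2.const_mul _).sub hU2).add hγ2
    calc ∫ ω in t, S (k + 1) ω ∂μ
        = c (k + 1) * ∫ ω in t, V (k + 1) ω ∂μ +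
          ∫ ω in t, (S k ω - c k * V k ω + c (k + 1) * (U k ω - γ k ω)) ∂μ := by
          simp_rw [e1]
          rw [integral_add (hV1.const_mul _) hI2, integral_const_mul]
      _ ≤ c (k + 1) * ∫ ω in t, ((1 + β k) * V k ω - U k ω + γ k ω) ∂μ +
          ∫ ω in t, (S k ω - c k * V k ω + c (k + 1) * (U k ω - γ k ω)) ∂μ := by
          exact add_le_add (mul_le_mul_of_nonneg_left (h k t hst hsub) (hc0 _).le) le_rfl
      _ = ∫ ω in t, (c (k + 1) * ((1 + β k) * V k ω - U k ω + γ k ω) +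
            (S k ω - c k * V k ω + c (k + 1) * (U k ω - γ k ω))) ∂μ := by
          rw [integral_add (hI3.const_mul _) hI2, integral_const_mul]
      _ ≤ ∫ ω in t, S k ω ∂μ := by
          refine integral_mono ((hI3.const_mul _).add hI2) hS2 fun ω => ?_
          have := mul_le_mul_of_nonneg_right (hcβ k) (hV0 k ω)
          simp only
          linarith
  have hL1 : ∀ n, eLpNorm ((-Y) n) 1 μ ≤ (Real.toNNReal (∫ ω, Y 0 ω ∂μ) : ENNReal) := by
    intro n
    have h1 := hsuper.setIntegral_le (Nat.zero_le n) (MeasurableSet.univ)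
    simp only [Measure.restrict_univ] at h1
    rw [Pi.neg_apply, eLpNorm_neg, eLpNorm_one_eq_lintegral_enorm,
      ← ofReal_integral_norm_eq_lintegral_enorm (hIY n)]
    refine ENNReal.ofReal_le_ofReal ?_
    simpa only [Real.norm_of_nonneg (hY0 n _)] using h1
  filter_upwards [hsuper.neg.exists_ae_tendsto_of_bdd hL1] with ω ⟨y, hy⟩ hω
  have hy' : Tendsto (fun k => S k ω) atTop (𝓝 (-y)) := by
    refine hy.neg.congr fun k => ?_
    simp [Y, Set.indicator_of_mem hω]
  have hγs : Summable fun j => c (j + 1) * γ j ω :=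
    summable_of_sum_range_le (fun j => mul_nonneg (hc0 _).le (hγ0 _ _)) (hγK ω hω)
  have hT : Tendsto (fun k => c k * V k ω + ∑ j ∈ Finset.range k, c (j + 1) * U j ω) atTop
      (𝓝 (-y - K + ∑' j, c (j + 1) * γ j ω)) := by
    refine ((hy'.sub_const K).add hγs.hasSum.tendsto_sum_nat).congr fun k => ?_
    simp only [S, mul_sub, Finset.sum_sub_distrib]
    ring
  obtain ⟨C, hC⟩ := hT.bddAbove_range
  have hcU : Summable fun j => c (j + 1) * U j ω := by
    refine summable_of_sum_range_le (c := C) (fun j => mul_nonneg (hc0 _).le (hU0 _ _)) fun n => ?_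
    have h1 := hC ⟨n, rfl⟩
    have h2 := mul_nonneg (hc0 n).le (hV0 n ω)
    simp only at h1
    linarith
  have hpos := Real.exp_pos (-∑' j, β j)
  refine ⟨?_, ?_⟩
  · have h1 : Tendsto (fun k => c k * V k ω) atTop (𝓝 _) :=
      (hT.sub hcU.hasSum.tendsto_sum_nat).congr fun k => by ring
    refine ⟨_, (h1.div hcl hpos.ne').congr fun k => ?_⟩
    simp only [Pi.div_apply]
    rw [mul_div_cancel_left₀ _ (hc0 k).ne']
  · refine Summable.of_nonneg_of_le (fun j => hU0 j ω) (fun j => ?_)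
      (hcU.mul_left (Real.exp (-∑' j, β j))⁻¹)
    rw [← mul_assoc]
    refine le_mul_of_one_le_left (hU0 j ω) ?_
    rw [← div_eq_inv_mul, one_le_div hpos]
    exact hcinf _

/-! ### Weak convergence to a fixed point -/

section Opial

variable {E : Type*} [NormedAddCommGroup E] [InnerProductSpace ℝ E]

/-- The Banach-Alaoglu theorem in a Hilbert space: along an ultrafilter, a bounded family
converges weakly. -/
lemma exists_weak_limit_ultrafilter [CompleteSpace E] {ι : Type*} (x : ι → E) {C : ℝ}
    (hx : ∀ k, ‖x k‖ ≤ C) (𝒰 : Ultrafilter ι) :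
    ∃ y, ∀ u, Tendsto (fun k => inner ℝ (x k) u) 𝒰 (𝓝 (inner ℝ y u)) := by
  let f : ι → WeakDual ℝ E := fun k => StrongDual.toWeakDual (InnerProductSpace.toDual ℝ E (x k))
  have hK := WeakDual.isCompact_closedBall (𝕜 := ℝ) (0 : StrongDual ℝ E) C
  obtain ⟨a, -, ha⟩ := hK.ultrafilter_le_nhds (𝒰.map f) (by
    rw [Ultrafilter.coe_map, le_principal_iff]
    refine mem_map.2 (univ_mem' fun k => ?_)
    simpa [f] using hx k)
  refine ⟨(InnerProductSpace.toDual ℝ E).symm (WeakDual.toStrongDual a), fun u => ?_⟩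
  rw [InnerProductSpace.toDual_symm_apply]
  have h1 : Tendsto f 𝒰 (𝓝 a) := ha
  exact ((WeakDual.eval_continuous u).tendsto a).comp h1

/-- Demiclosedness at zero of `T - id` for a nonexpansive map `T`. -/
lemma isFixedPt_of_weak_limit {T : E → E} (hT : LipschitzWith 1 T) {ι : Type*} {l : Filter ι}
    [l.NeBot] {x : ι → E} {C : ℝ} (hx : ∀ k, ‖x k‖ ≤ C) {y : E}
    (hy : ∀ u, Tendsto (fun k => inner ℝ (x k) u) l (𝓝 (inner ℝ y u)))
    (hres : Tendsto (fun k => ‖T (x k) - x k‖) l (𝓝 0)) : T y = y := by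
  have hle : ∀ k, ‖y - T y‖ ^ 2 ≤ -2 * (inner ℝ (x k) (y - T y) - inner ℝ y (y - T y)) +
      (‖T (x k) - x k‖ ^ 2 + 2 * (‖T (x k) - x k‖ * (C + ‖y‖))) := by
    intro k
    have h1 : ‖x k - T y‖ ≤ ‖T (x k) - x k‖ + ‖x k - y‖ := by
      have h2 : ‖T (x k) - T y‖ ≤ ‖x k - y‖ := by
        simpa [dist_eq_norm] using hT.dist_le_mul (x k) y
      calc ‖x k - T y‖ = ‖-(T (x k) - x k) + (T (x k) - T y)‖ := by congr 1; abel
        _ ≤ _ := (norm_add_le _ _).trans (by rw [norm_neg]; gcongr)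
    have h3 : ‖x k - T y‖ ^ 2 =
        ‖x k - y‖ ^ 2 + 2 * inner ℝ (x k - y) (y - T y) + ‖y - T y‖ ^ 2 := by
      rw [← norm_add_sq_real]; congr 2; abel
    have h4 : ‖x k - y‖ ≤ C + ‖y‖ := (norm_sub_le _ _).trans (by gcongr; exact hx k)
    have h5 := pow_le_pow_left₀ (norm_nonneg _) h1 2
    have h6 := mul_le_mul_of_nonneg_left h4 (norm_nonneg (T (x k) - x k))
    rw [← inner_sub_left]
    nlinarith
  have hlim : Tendsto (fun k => -2 * (inner ℝ (x k) (y - T y) - inner ℝ y (y - T y)) +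
      (‖T (x k) - x k‖ ^ 2 + 2 * (‖T (x k) - x k‖ * (C + ‖y‖)))) l (𝓝 0) := by
    have := (((hy (y - T y)).sub_const (inner ℝ y (y - T y))).const_mul (-2)).add
      ((hres.pow 2).add ((hres.mul_const (C + ‖y‖)).const_mul 2))
    simpa using this
  have h0 : ‖y - T y‖ ^ 2 ≤ 0 := ge_of_tendsto' hlim hle
  have h1 : ‖y - T y‖ = 0 := by nlinarith [norm_nonneg (y - T y)]
  exact (sub_eq_zero.1 (norm_eq_zero.1 h1)).symm

/-- Opial's lemma for the inner product `⟪W ·, ·⟫`: the distances to a dense set of fixed points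
determine `⟪x k, W (z - z')⟫` in the limit, which separates any two weak cluster points. -/
theorem exists_fixedPt_weak_limit [CompleteSpace E] {T : E → E} (hT : LipschitzWith 1 T)
    {W : E →L[ℝ] E} (hsymm : ∀ y z, inner ℝ (W y) z = inner ℝ y (W z))
    (hpos : ∀ y, inner ℝ (W y) y = 0 → y = 0) {x : ℕ → E} {C : ℝ} (hx : ∀ k, ‖x k‖ ≤ C)
    (hres : Tendsto (fun k => ‖T (x k) - x k‖) atTop (𝓝 0)) {D : Set E}
    (hD : Function.fixedPoints T ⊆ closure D)
    (hdist : ∀ z ∈ D, ∃ l,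
      Tendsto (fun k => inner ℝ (W (x k - z)) (x k - z)) atTop (𝓝 l)) :
    ∃ y ∈ Function.fixedPoints T, ∀ u, Tendsto (fun k => inner ℝ (x k) u) atTop
      (𝓝 (inner ℝ y u)) := by
  -- Polarization: the quadratic terms in `x k` cancel in the difference of the two distances.
  have hdiff : ∀ z ∈ D, ∀ z' ∈ D, ∃ l,
      Tendsto (fun k => inner ℝ (x k) (W (z - z'))) atTop (𝓝 l) := by
    intro z hz z' hz'
    obtain ⟨l, hl⟩ := hdist z hz
    obtain ⟨l', hl'⟩ := hdist z' hz'
    refine ⟨_, (((hl'.sub hl).add_const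
      (inner ℝ (W z) z - inner ℝ (W z') z')).div_const 2).congr fun k => ?_⟩
    simp only [map_sub, inner_sub_left, inner_sub_right, hsymm]
    rw [← hsymm z (x k), ← hsymm z' (x k), real_inner_comm (x k) (W z),
      real_inner_comm (x k) (W z')]
    ring
  have hcluster : ∀ 𝒰 : Ultrafilter ℕ, (𝒰 : Filter ℕ) ≤ atTop → ∃ y ∈ Function.fixedPoints T,
      ∀ u, Tendsto (fun k => inner ℝ (x k) u) 𝒰 (𝓝 (inner ℝ y u)) := by
    intro 𝒰 h𝒰
    obtain ⟨y, hy⟩ := exists_weak_limit_ultrafilter x hx 𝒰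
    exact ⟨y, isFixedPt_of_weak_limit hT hx hy (hres.mono_left h𝒰), hy⟩
  obtain ⟨y, hyT, hy⟩ := hcluster (hyperfilter ℕ) (Nat.hyperfilter_le_atTop)
  refine ⟨y, hyT, fun u => (tendsto_iff_ultrafilter _ _ _).2 fun 𝒰 h𝒰 => ?_⟩
  obtain ⟨y', hyT', hy'⟩ := hcluster 𝒰 h𝒰
  suffices y = y' by rw [this]; exact hy' u
  have hcont : Continuous fun z : E => inner ℝ (y - y') (W z) := by fun_prop
  have hconst : ∀ z ∈ D, ∀ z' ∈ D, inner ℝ (y - y') (W z) = inner ℝ (y - y') (W z') := by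
    intro z hz z' hz'
    obtain ⟨l, hl⟩ := hdiff z hz z' hz'
    have h1 := tendsto_nhds_unique (hy (W (z - z'))) (hl.mono_left Nat.hyperfilter_le_atTop)
    have h2 := tendsto_nhds_unique (hy' (W (z - z'))) (hl.mono_left h𝒰)
    have h3 : inner ℝ (y - y') (W (z - z')) = 0 := by rw [inner_sub_left, h1, h2, sub_self]
    rwa [map_sub, inner_sub_right, sub_eq_zero] at h3
  -- `⟪y - y', W ·⟫` is constant on `D`, hence on its closure, which contains `y` and `y'`.
  have hext : ∀ z ∈ D, ∀ z' ∈ closure D, inner ℝ (y - y') (W z) = inner ℝ (y - y') (W z') :=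
    fun z hz z' hz' => closure_minimal (fun z' hz' => hconst z hz z' hz')
      (isClosed_eq continuous_const hcont) hz'
  obtain ⟨z, hz⟩ : D.Nonempty := closure_nonempty_iff.1 ⟨y, hD hyT⟩
  have h1 := (hext z hz y (hD hyT)).symm.trans (hext z hz y' (hD hyT'))
  rw [← sub_eq_zero, ← inner_sub_right, ← map_sub, ← hsymm] at h1
  exact sub_eq_zero.1 (hpos _ h1)

end Opial

/-! ### The weighted inner product -/

section Weighted

variable {m : ℕ} {H : Fin m → Type*} [∀ l, NormedAddCommGroup (H l)]
  [∀ l, InnerProductSpace ℝ (H l)]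

/-- The operator that multiplies block `l` by `1 / p l`, which represents the weighted inner
product. -/
noncomputable def weightOp (p : Fin m → ℝ) : PiLp 2 H →L[ℝ] PiLp 2 H :=
  (PiLp.continuousLinearEquiv 2 ℝ H).symm.toContinuousLinearMap ∘L
    (ContinuousLinearMap.pi fun l => (1 / p l) • ContinuousLinearMap.proj l) ∘L
      (PiLp.continuousLinearEquiv 2 ℝ H).toContinuousLinearMap

@[simp]
lemma weightOp_apply (p : Fin m → ℝ) (y : PiLp 2 H) (l : Fin m) :
    weightOp p y l = (1 / p l) • y l := rfl

lemma inner_weightOp_left (p : Fin m → ℝ) (y z : PiLp 2 H) :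
    inner ℝ (weightOp p y) z = weightedInner p y z := by
  simp [PiLp.inner_apply, weightedInner, real_inner_smul_left]

lemma inner_weightOp_right (p : Fin m → ℝ) (y z : PiLp 2 H) :
    inner ℝ y (weightOp p z) = weightedInner p y z := by
  simp [PiLp.inner_apply, weightedInner, real_inner_smul_right]

lemma weightedInner_self_le (p : Fin m → ℝ) (y : PiLp 2 H) :
    weightedInner p y y ≤ ‖weightOp (H := H) p‖ * ‖y‖ ^ 2 := by
  rw [← inner_weightOp_left, sq, ← mul_assoc]
  exact (real_inner_le_norm _ _).trans
    (mul_le_mul_of_nonneg_right (ContinuousLinearMap.le_opNorm _ _) (norm_nonneg _))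

lemma norm_sq_le_weightedInner_self {p : Fin m → ℝ} (hp0 : ∀ l, 0 < p l) (hp1 : ∀ l, p l ≤ 1)
    (y : PiLp 2 H) : ‖y‖ ^ 2 ≤ weightedInner p y y := by
  rw [PiLp.norm_sq_eq_of_L2, weightedInner]
  refine Finset.sum_le_sum fun l _ => ?_
  rw [real_inner_self_eq_norm_sq]
  exact le_mul_of_one_le_left (sq_nonneg _) ((one_le_div (hp0 l)).2 (hp1 l))

/-- If block `l` moves from `x l` to `x l + (β l * α) • y l` with `β l ∈ {0, 1}`, then the energy
changes by `∑ l, β l / p l * (blockIncrement α x y l)`; this is the unweighted change that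
block `l` causes when it is active. -/
noncomputable def blockIncrement (α : ℝ) (x y : PiLp 2 H) (l : Fin m) : ℝ :=
  2 * α * inner ℝ (x l) (y l) + α ^ 2 * ‖y l‖ ^ 2

lemma weightedInner_self_step (p : Fin m → ℝ) {α : ℝ} {β : Fin m → ℝ}
    (hβ : ∀ l, β l = 0 ∨ β l = 1) {x x' y : PiLp 2 H}
    (hx' : ∀ l, x' l = x l + (β l * α) • y l) :
    weightedInner p x' x' =
      weightedInner p x x + ∑ l, 1 / p l * (β l * blockIncrement α x y l) := by
  simp only [weightedInner, ← Finset.sum_add_distrib, hx', blockIncrement,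
    real_inner_self_eq_norm_sq]
  refine Finset.sum_congr rfl fun l _ => ?_
  rw [norm_add_sq_real, norm_smul, real_inner_smul_right, mul_pow, Real.norm_eq_abs, sq_abs]
  rcases hβ l with h | h <;> rw [h] <;> ring

lemma sum_blockIncrement (α : ℝ) (x y : PiLp 2 H) :
    ∑ l, blockIncrement α x y l = 2 * α * inner ℝ x y + α ^ 2 * ‖y‖ ^ 2 := by
  simp only [blockIncrement, Finset.sum_add_distrib, ← Finset.mul_sum, PiLp.inner_apply,
    PiLp.norm_sq_eq_of_L2]

lemma abs_blockIncrement_le {α : ℝ} (hα : 0 ≤ α) (x y : PiLp 2 H) (l : Fin m) :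
    |blockIncrement α x y l| ≤ 2 * α * (‖x‖ * ‖y‖) + α ^ 2 * ‖y‖ ^ 2 := by
  have hx : ‖x l‖ ≤ ‖x‖ := PiLp.norm_apply_le x l
  have hy : ‖y l‖ ≤ ‖y‖ := PiLp.norm_apply_le y l
  have h1 : |inner ℝ (x l) (y l)| ≤ ‖x‖ * ‖y‖ :=
    (abs_real_inner_le_norm _ _).trans (mul_le_mul hx hy (norm_nonneg _) (norm_nonneg _))
  refine (abs_add_le _ _).trans ?_
  rw [abs_mul, abs_of_nonneg (by positivity : 0 ≤ 2 * α),
    abs_of_nonneg (by positivity : 0 ≤ α ^ 2 * ‖y l‖ ^ 2)]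
  gcongr

end Weighted

/-! ### One step of the iteration -/

section Step

variable {N : ℕ} {E : Type*} [NormedAddCommGroup E] [NormedSpace ℝ E]

lemma mean_sub (v w : Fin N → E) : mean (v - w) = mean v - mean w := by
  simp [mean, Finset.sum_sub_distrib, smul_sub]

lemma globalOp_sub_self (hN : 0 < N) (F : Fin N → E → E) (x : E) :
    globalOp F x - x = mean fun i => F i x - x := by
  have hN' : (N : ℝ) ≠ 0 := by exact_mod_cast hN.ne'
  simp [globalOp, mean, Finset.sum_sub_distrib, smul_sub, ← Nat.cast_smul_eq_nsmul ℝ, smul_smul,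
    hN']

lemma lipschitzWith_globalOp (hN : 0 < N) {F : Fin N → E → E} (hF : ∀ i, LipschitzWith 1 (F i)) :
    LipschitzWith 1 (globalOp F) := by
  refine LipschitzWith.of_dist_le_mul fun x y => ?_
  rw [dist_eq_norm, dist_eq_norm, NNReal.coe_one, one_mul]
  calc ‖globalOp F x - globalOp F y‖ = ‖mean ((fun i => F i x) - fun i => F i y)‖ := by
        rw [mean_sub]; rfl
    _ ≤ _ := norm_mean_le hN fun i => by
        simpa [dist_eq_norm] using (hF i).dist_le_mul x y

lemma norm_sub_mean_le_disagreement (v : Fin N → E) (i : Fin N) :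
    ‖v i - mean v‖ ≤ disagreement v :=
  Finset.single_le_sum (f := fun i => ‖v i - mean v‖) (fun _ _ => norm_nonneg _)
    (Finset.mem_univ i)

/-- A nonexpansive map whose displacement at `x` is perturbed by `e` decreases the squared
distance to its fixed points, up to terms that the step `α` makes square-summable. -/
lemma perturbed_step_le {E : Type*} [NormedAddCommGroup E] [InnerProductSpace ℝ E] {T : E → E}
    (hT : LipschitzWith 1 T) {x y z : E} (hz : T z = z) {α B d : ℝ} (hα : 0 ≤ α)
    (hy : ‖y‖ ≤ B) (hd : ‖y - (T x - x)‖ ≤ d) :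
    2 * α * inner ℝ (x - z) y + α ^ 2 * ‖y‖ ^ 2 ≤
      α ^ 2 * ‖x - z‖ ^ 2 - α * ‖T x - x‖ ^ 2 + (d ^ 2 + B ^ 2 * α ^ 2) := by
  have h1 : 2 * inner ℝ (x - z) (T x - x) ≤ -‖T x - x‖ ^ 2 := by
    have h2 : ‖T x - z‖ ≤ ‖x - z‖ := by
      simpa [dist_eq_norm, hz] using hT.dist_le_mul x z
    have h3 : ‖T x - z‖ ^ 2 =
        ‖x - z‖ ^ 2 + 2 * inner ℝ (x - z) (T x - x) + ‖T x - x‖ ^ 2 := by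
      rw [← norm_add_sq_real]; congr 2; abel
    have h4 := pow_le_pow_left₀ (norm_nonneg _) h2 2
    linarith
  have h5 : inner ℝ (x - z) y = inner ℝ (x - z) (T x - x) + inner ℝ (x - z) (y - (T x - x)) := by
    rw [← inner_add_right]; congr 1; abel
  have h6 : inner ℝ (x - z) (y - (T x - x)) ≤ ‖x - z‖ * ‖y - (T x - x)‖ := real_inner_le_norm _ _
  have h7 : ‖y - (T x - x)‖ ^ 2 ≤ d ^ 2 := pow_le_pow_left₀ (norm_nonneg _) hd 2
  have h8 : ‖y‖ ^ 2 ≤ B ^ 2 := pow_le_pow_left₀ (norm_nonneg _) hy 2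
  have h9 := mul_le_mul_of_nonneg_left h6 hα
  have h10 := mul_le_mul_of_nonneg_left h8 (sq_nonneg α)
  have h11 := mul_le_mul_of_nonneg_left h1 hα
  rw [h5]
  -- Young's inequality `2 * (α * ‖x - z‖) * ‖e‖ ≤ α ^ 2 * ‖x - z‖ ^ 2 + ‖e‖ ^ 2` keeps the factor of
  -- the energy deterministic.
  nlinarith [sq_nonneg (α * ‖x - z‖ - ‖y - (T x - x)‖)]

variable {m : ℕ} {H : Fin m → Type*} [∀ l, NormedAddCommGroup (H l)]
  [∀ l, InnerProductSpace ℝ (H l)]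

/-- The average displacement of the agents at their aggregates: the direction in which the
average of the states moves. -/
noncomputable def direction (F : Fin N → PiLp 2 H → PiLp 2 H) (A : Matrix (Fin N) (Fin N) ℝ)
    (v : Fin N → PiLp 2 H) : PiLp 2 H :=
  mean fun i => F i (aggregate A v i) - aggregate A v i

variable {F : Fin N → PiLp 2 H → PiLp 2 H} {A : Matrix (Fin N) (Fin N) ℝ}

lemma mean_aggregate (hA : A ∈ doublyStochastic ℝ (Fin N)) (v : Fin N → PiLp 2 H) :
    mean (aggregate A v) = mean v := mean_mul hA v

lemma norm_direction_le (hN : 0 < N) {B : ℝ} (hB : ∀ i x, ‖F i x - x‖ ≤ B)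
    (v : Fin N → PiLp 2 H) : ‖direction F A v‖ ≤ B :=
  norm_mean_le hN fun _ => hB _ _

lemma norm_direction_sub_le (hN : 0 < N) (hF : ∀ i, LipschitzWith 1 (F i))
    (hA : A ∈ doublyStochastic ℝ (Fin N)) (v : Fin N → PiLp 2 H) :
    ‖direction F A v - (globalOp F (mean v) - mean v)‖ ≤ disagreement v := by
  have h1 : direction F A v - (globalOp F (mean v) - mean v) =
      mean ((fun i => F i (aggregate A v i)) - fun i => F i (mean v)) := by
    have h2 : direction F A v = mean (fun i => F i (aggregate A v i)) - mean v := by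
      rw [← mean_aggregate hA v, ← mean_sub]; rfl
    have h3 : globalOp F (mean v) = mean fun i => F i (mean v) := rfl
    rw [h2, h3, mean_sub]
    abel
  rw [h1]
  refine norm_mean_le hN fun i => ?_
  calc ‖F i (aggregate A v i) - F i (mean v)‖ ≤ ‖aggregate A v i - mean (aggregate A v)‖ := by
        rw [mean_aggregate hA]
        simpa [dist_eq_norm] using (hF i).dist_le_mul (aggregate A v i) (mean v)
    _ ≤ disagreement (aggregate A v) := norm_sub_mean_le_disagreement _ i
    _ ≤ disagreement v := by
        have h2 : disagreement (aggregate A v) ≤ (1 - N * 0) * disagreement v :=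
          disagreement_mul_le hN hA (fun i j => nonneg_of_mem_doublyStochastic hA) v
        simpa using h2

variable {α : ℝ} {β : Fin m → ℝ} {v v' : Fin N → PiLp 2 H}

lemma norm_step_sub_aggregate_le (hα : 0 ≤ α) (hβ : ∀ l, β l = 0 ∨ β l = 1) {B : ℝ}
    (hB : ∀ i x, ‖F i x - x‖ ≤ B)
    (hv : ∀ i l, v' i l = aggregate A v i l +
      (β l * α) • (F i (aggregate A v i) l - aggregate A v i l)) (i : Fin N) :
    ‖v' i - aggregate A v i‖ ≤ B * α := by
  have hB' : 0 ≤ B := (norm_nonneg _).trans (hB i 0)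
  have h1 : ‖v' i - aggregate A v i‖ ^ 2 ≤
      (α * ‖F i (aggregate A v i) - aggregate A v i‖) ^ 2 := by
    rw [mul_pow, PiLp.norm_sq_eq_of_L2, PiLp.norm_sq_eq_of_L2, Finset.mul_sum]
    refine Finset.sum_le_sum fun l _ => ?_
    rw [PiLp.sub_apply, hv, add_sub_cancel_left, norm_smul, ← mul_pow, PiLp.sub_apply]
    refine pow_le_pow_left₀ (by positivity) (mul_le_mul_of_nonneg_right ?_ (norm_nonneg _)) 2
    rcases hβ l with h | h <;> simp [h, hα, abs_of_nonneg]
  have h2 := abs_le_of_sq_le_sq h1 (by positivity)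
  rw [abs_of_nonneg (norm_nonneg _)] at h2
  rw [mul_comm B]
  exact h2.trans (mul_le_mul_of_nonneg_left (hB _ _) hα)

lemma mean_step (hA : A ∈ doublyStochastic ℝ (Fin N))
    (hv : ∀ i l, v' i l = aggregate A v i l +
      (β l * α) • (F i (aggregate A v i) l - aggregate A v i l)) (l : Fin m) :
    mean v' l = mean v l + (β l * α) • direction F A v l := by
  have happ : ∀ (w : Fin N → PiLp 2 H), mean w l = (1 / (N : ℝ)) • ∑ i, w i l := by
    intro w
    simp [mean]
  rw [← mean_aggregate hA v, direction, happ, happ, happ]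
  simp only [hv, Finset.sum_add_distrib, smul_add, ← Finset.smul_sum, PiLp.sub_apply]
  rw [smul_comm]

end Step

/-! ### Almost sure convergence of the energy -/

lemma setIntegral_mul_of_indep {Ω : Type*} {𝓗 mΩ : MeasurableSpace Ω} {μ : Measure Ω}
    [IsProbabilityMeasure μ] (h𝓗 : 𝓗 ≤ mΩ) {b f : Ω → ℝ} (hb : Measurable b)
    (hind : Indep (MeasurableSpace.comap b inferInstance) 𝓗 μ) (hf : Measurable[𝓗] f)
    {s : Set Ω} (hs : MeasurableSet[𝓗] s) :
    ∫ ω in s, b ω * f ω ∂μ = (∫ ω, b ω ∂μ) * ∫ ω in s, f ω ∂μ := by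
  have hsf : Measurable[𝓗] (s.indicator f) := hf.indicator hs
  have hbf : IndepFun b (s.indicator f) μ :=
    (IndepFun_iff_Indep _ _ _).2 (indep_of_indep_of_le_right hind hsf.comap_le)
  rw [← integral_indicator (h𝓗 _ hs), ← integral_indicator (h𝓗 _ hs),
    ← hbf.integral_fun_mul_eq_mul_integral hb.aestronglyMeasurable
      (hsf.mono h𝓗 le_rfl).aestronglyMeasurable]
  simp only [Set.indicator_mul_right]

lemma IsBlockSelection.integral_eq {N m : ℕ} {Ω E : Type*} [MeasurableSpace Ω]
    [MeasurableSpace E] {μ : Measure Ω} {b : Fin m → ℕ → Ω → ℝ} {X : Fin N → ℕ → Ω → E}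
    (hb : IsBlockSelection μ b X) (l : Fin m) (k : ℕ) :
    ∫ ω, b l k ω ∂μ = blockProb μ b l := by
  rw [(hb.identDistrib l k).integral_eq, blockProb]
  have h1 : b l 0 = {ω | b l 0 ω = 1}.indicator 1 := by
    ext ω
    rcases hb.zero_or_one l 0 ω with h | h <;> simp [Set.indicator, h]
  have h2 : MeasurableSet {ω | b l 0 ω = 1} := hb.measurable l 0 (measurableSet_singleton 1)
  conv_lhs => rw [h1]
  exact integral_indicator_one h2

lemma measurable_history {N : ℕ} {Ω E : Type*} [MeasurableSpace E] (X : Fin N → ℕ → Ω → E) (k : ℕ) (i : Fin N) :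
    Measurable[history X k] (X i k) :=
  (comap_measurable (X i k)).mono
    (le_iSup_of_le i (le_iSup₂_of_le (f := fun s (_ : s ≤ k) =>
      MeasurableSpace.comap (X i s) inferInstance) k le_rfl le_rfl)) le_rfl

lemma measurable_comp_history {N : ℕ} {Ω E : Type*} [TopologicalSpace E]
    [SecondCountableTopology E] [MeasurableSpace E] [BorelSpace E] (X : Fin N → ℕ → Ω → E) (k : ℕ)
    {g : (Fin N → E) → ℝ} (hg : Continuous g) :
    Measurable[history X k] fun ω => g fun i => X i k ω :=
  hg.measurable.comp (@measurable_pi_lambda _ _ _ (history X k) _ _ (measurable_history X k))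

lemma continuous_mean {N : ℕ} {E : Type*} [NormedAddCommGroup E] [NormedSpace ℝ E] :
    Continuous (mean : (Fin N → E) → E) := by
  unfold mean
  fun_prop

lemma continuous_disagreement {N : ℕ} {E : Type*} [NormedAddCommGroup E] [NormedSpace ℝ E] :
    Continuous (disagreement : (Fin N → E) → ℝ) := by
  have := continuous_mean (N := N) (E := E)
  unfold disagreement
  fun_prop

section Pathwise

variable {N m : ℕ} {H : Fin m → Type*} [∀ l, NormedAddCommGroup (H l)]
  [∀ l, InnerProductSpace ℝ (H l)] {Ω : Type*}
  {F : Fin N → PiLp 2 H → PiLp 2 H} {A : ℕ → Matrix (Fin N) (Fin N) ℝ} {α : ℕ → ℝ}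
  {b : Fin m → ℕ → Ω → ℝ} {X : Fin N → ℕ → Ω → PiLp 2 H}

lemma continuous_aggregate (M : Matrix (Fin N) (Fin N) ℝ) (i : Fin N) :
    Continuous fun v : Fin N → PiLp 2 H => aggregate M v i := by
  unfold aggregate
  fun_prop

lemma continuous_direction (hF : ∀ i, LipschitzWith 1 (F i)) (M : Matrix (Fin N) (Fin N) ℝ) :
    Continuous (direction F M) := by
  refine continuous_mean.comp (continuous_pi fun i => ?_)
  exact ((hF i).continuous.comp (continuous_aggregate M i)).sub (continuous_aggregate M i)

/-- All states stay within `R + k * B` until time `k` when the initial states lie within `R`. -/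
lemma IsIteration.norm_le (hX : IsIteration A α b F X) (hA : ∀ k, A k ∈ doublyStochastic ℝ (Fin N))
    (hα0 : ∀ k, 0 ≤ α k) (hα1 : ∀ k, α k ≤ 1) (hb : ∀ l k ω, b l k ω = 0 ∨ b l k ω = 1)
    {B : ℝ} (hB : ∀ i x, ‖F i x - x‖ ≤ B) {R : ℝ} {ω : Ω} (hR : ∀ i, ‖X i 0 ω‖ ≤ R)
    (k : ℕ) (i : Fin N) : ‖X i k ω‖ ≤ R + k * B := by
  have hB0 : 0 ≤ B := (norm_nonneg _).trans (hB i 0)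
  induction k generalizing i with
  | zero => simpa using hR i
  | succ k ih =>
    have h1 := norm_step_sub_aggregate_le (v := fun j => X j k ω) (v' := fun j => X j (k + 1) ω)
      (β := fun l => b l k ω) (hα0 k) (fun l => hb l k ω) hB (fun i l => hX i k l ω) i
    have h2 : ‖aggregate (A k) (fun j => X j k ω) i‖ ≤ R + k * B := norm_sum_smul_le (hA k) ih i
    have h3 := norm_le_norm_add_norm_sub' (X i (k + 1) ω) (aggregate (A k) (fun j => X j k ω) i)
    have h4 : B * α k ≤ B := mul_le_of_le_one_right hB0 (hα1 k)
    push_cast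
    linarith

end Pathwise

section RandomIterates

variable {N m : ℕ} {H : Fin m → Type*} [∀ l, NormedAddCommGroup (H l)]
  [∀ l, InnerProductSpace ℝ (H l)] [∀ l, SecondCountableTopology (H l)]
  [∀ l, MeasurableSpace (H l)] [∀ l, BorelSpace (H l)]
  {Ω : Type*} [mΩ : MeasurableSpace Ω] {μ : Measure Ω}
  {F : Fin N → PiLp 2 H → PiLp 2 H} {A : ℕ → Matrix (Fin N) (Fin N) ℝ} {α : ℕ → ℝ}
  {b : Fin m → ℕ → Ω → ℝ} {X : Fin N → ℕ → Ω → PiLp 2 H}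

lemma IsIteration.measurable (hX : IsIteration A α b F X) (hF : ∀ i, LipschitzWith 1 (F i))
    (hb : ∀ l k, Measurable (b l k)) (hX₀ : ∀ i, Measurable (X i 0)) (k : ℕ) (i : Fin N) :
    Measurable (X i k) := by
  induction k generalizing i with
  | zero => exact hX₀ i
  | succ k ih =>
    have hagg : Measurable fun ω => aggregate (A k) (fun j => X j k ω) i :=
      (continuous_aggregate (A k) i).measurable.comp (measurable_pi_lambda _ ih)
    have hFagg := (hF i).continuous.measurable.comp hagg
    have hcoord : ∀ l, Measurable fun x : PiLp 2 H => x l := fun l =>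
      (PiLp.continuous_apply 2 H l).measurable
    have h1 : X i (k + 1) = fun ω => WithLp.toLp 2 fun l => X i (k + 1) ω l := rfl
    rw [h1]
    refine (WithLp.measurable_toLp 2 _).comp (measurable_pi_lambda _ fun l => ?_)
    simp only [hX i k l]
    exact ((hcoord l).comp hagg).add (((hb l k).mul_const _).smul
      (((hcoord l).comp hFagg).sub ((hcoord l).comp hagg)))

/-- The natural filtration of the iterates. -/
def historyFiltration (hX : ∀ k i, Measurable (X i k)) : Filtration ℕ mΩ where
  seq := history X
  mono' _ _ hkk' := iSup_mono fun _ => iSup_mono fun _ => iSup_mono' fun h => ⟨h.trans hkk', le_rfl⟩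
  le' _ := iSup_le fun i => iSup_le fun s => iSup_le fun _ => (hX s i).comap_le

/-- The energy of the average relative to a fixed point converges almost surely, on the event that
the initial states lie within `R`; there all states at a given time are bounded, so that the
energies are integrable without any moment assumption on the initial states. -/
theorem ae_energy_tendsto [IsProbabilityMeasure μ] (hN : 0 < N) (hF : ∀ i, LipschitzWith 1 (F i))
    {B : ℝ} (hB : ∀ i x, ‖F i x - x‖ ≤ B) {G : ℕ → Digraph (Fin N)}
    (hA : IsAdjacency G A) (hG : UniformlyJointlyStronglyConnected G) (hW : WeightsRule A)
    (hα : Antitone α) (hα0 : ∀ k, 0 ≤ α k) (hα1 : ∀ k, α k ≤ 1)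
    (hα2 : Summable fun k => α k ^ 2) (hX₀ : ∀ i, Measurable (X i 0))
    (hb : IsBlockSelection μ b X) (hX : IsIteration A α b F X) {z : PiLp 2 H}
    (hz : globalOp F z = z) (R : ℝ) :
    ∀ᵐ ω ∂μ, (∀ i, ‖X i 0 ω‖ ≤ R) →
      (∃ l, Tendsto (fun k => weightedInner (blockProb μ b) ((mean fun i => X i k ω) - z)
        ((mean fun i => X i k ω) - z)) atTop (𝓝 l)) ∧
      Summable fun k => α k *
        ‖globalOp F (mean fun i => X i k ω) - mean fun i => X i k ω‖ ^ 2 := by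
  have hB0 : 0 ≤ B := (norm_nonneg _).trans (hB ⟨0, hN⟩ 0)
  have hds := mem_doublyStochastic_of_weightsRule hA hW
  have hXm := hX.measurable hF hb.measurable hX₀
  let ℱ := historyFiltration hXm
  let p := blockProb μ b
  have hp0 : ∀ l, 0 < p l := hb.prob_pos
  have hp1 : ∀ l, p l ≤ 1 := fun l => measureReal_le_one
  let S : Set Ω := {ω | ∀ i, ‖X i 0 ω‖ ≤ R}
  have hS : MeasurableSet[ℱ 0] S := by
    have : S = ⋂ i, {ω | ‖X i 0 ω‖ ≤ R} := by ext; simp [S]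
    rw [this]
    refine MeasurableSet.iInter fun i => ?_
    have h1 : Measurable[ℱ 0] fun ω => ‖X i 0 ω‖ :=
      continuous_norm.measurable.comp (measurable_history X 0 i)
    exact h1 measurableSet_Iic
  have hbound : ∀ k, ∀ ω ∈ S, ∀ i, ‖X i k ω‖ ≤ R + k * B := fun k ω hω =>
    hX.norm_le hds hα0 hα1 hb.zero_or_one hB hω k
  have hmeanb : ∀ k, ∀ ω ∈ S, ‖(mean fun i => X i k ω) - z‖ ≤ R + k * B + ‖z‖ := fun k ω hω =>
    (norm_sub_le _ _).trans (by gcongr; exact norm_mean_le hN (hbound k ω hω))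
  have hstep : ∀ k i ω, ‖X i (k + 1) ω - ∑ j, A k i j • X j k ω‖ ≤ B * α k := fun k i ω =>
    norm_step_sub_aggregate_le (v := fun j => X j k ω) (v' := fun j => X j (k + 1) ω)
      (β := fun l => b l k ω) (hα0 k) (fun l => hb.zero_or_one l k ω) hB
      (fun i l => hX i k l ω) i
  let V : ℕ → Ω → ℝ := fun k ω =>
    weightedInner p ((mean fun i => X i k ω) - z) ((mean fun i => X i k ω) - z)
  let U : ℕ → Ω → ℝ := fun k ω =>
    α k * ‖globalOp F (mean fun i => X i k ω) - mean fun i => X i k ω‖ ^ 2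
  let γ : ℕ → Ω → ℝ := fun k ω => disagreement (fun i => X i k ω) ^ 2 + B ^ 2 * α k ^ 2
  let W : Fin m → ℕ → Ω → ℝ := fun l k ω => blockIncrement (α k) ((mean fun i => X i k ω) - z)
    (direction F (A k) fun i => X i k ω) l
  have hglob : Continuous (globalOp F) := (lipschitzWith_globalOp hN hF).continuous
  have hmean := continuous_mean (N := N) (E := PiLp 2 H)
  have hdis := continuous_disagreement (N := N) (E := PiLp 2 H)
  have hV : ∀ k, Measurable[ℱ k] (V k) := fun k =>
    measurable_comp_history X k (g := fun v => weightedInner p (mean v - z) (mean v - z)) (by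
      simp only [← inner_weightOp_left]; fun_prop)
  have hU : ∀ k, Measurable[ℱ k] (U k) := fun k =>
    measurable_comp_history X k (g := fun v => α k * ‖globalOp F (mean v) - mean v‖ ^ 2) (by
      fun_prop)
  have hγ : ∀ k, Measurable[ℱ k] (γ k) := fun k =>
    measurable_comp_history X k (g := fun v => disagreement v ^ 2 + B ^ 2 * α k ^ 2) (by fun_prop)
  have hWm : ∀ l k, Measurable[ℱ k] (W l k) := fun l k =>
    measurable_comp_history X k
      (g := fun v => blockIncrement (α k) (mean v - z) (direction F (A k) v) l) (by
        have := continuous_direction hF (A k)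
        have hc := PiLp.continuous_apply 2 H l
        unfold blockIncrement
        exact (continuous_const.mul ((hc.comp (hmean.sub continuous_const)).inner
          (hc.comp this))).add (continuous_const.mul ((hc.comp this).norm.pow 2)))
  have hV0 : ∀ k ω, 0 ≤ V k ω := fun k ω =>
    (sq_nonneg _).trans (norm_sq_le_weightedInner_self hp0 hp1 _)
  have hr : ∀ x, ‖globalOp F x - x‖ ≤ B := fun x => by
    rw [globalOp_sub_self hN]
    exact norm_mean_le hN fun i => hB i x
  have hVb : ∀ k, ∀ ω ∈ S, V k ω ≤ ‖weightOp (H := H) p‖ * (R + k * B + ‖z‖) ^ 2 :=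
    fun k ω hω => (weightedInner_self_le p _).trans (by gcongr; exact hmeanb k ω hω)
  have hUb : ∀ k, ∀ ω ∈ S, U k ω ≤ α k * B ^ 2 := fun k ω _ =>
    mul_le_mul_of_nonneg_left (pow_le_pow_left₀ (norm_nonneg _) (hr _) 2) (hα0 k)
  obtain ⟨K, hK⟩ := exists_sum_disagreement_sq_le (E := PiLp 2 H) hN hA hG hW hα hα2 hB0 (2 * N * R)
  have hγb : ∀ ω ∈ S, ∀ n, ∑ k ∈ Finset.range n, γ k ω ≤ K + B ^ 2 * ∑' k, α k ^ 2 := by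
    intro ω hω n
    simp only [γ, Finset.sum_add_distrib, ← Finset.mul_sum]
    gcongr
    · exact hK (fun k i => X i k ω) (fun k i => hstep k i ω) (disagreement_le_of_norm_le hN hω) n
    · exact hα2.sum_le_tsum _ fun _ _ => sq_nonneg _
  have hdrift : ∀ k ω, ∑ l, W l k ω ≤ α k ^ 2 * V k ω - U k ω + γ k ω := by
    intro k ω
    simp only [W, sum_blockIncrement]
    refine (perturbed_step_le (lipschitzWith_globalOp hN hF) hz (hα0 k)
      (norm_direction_le hN hB _) (norm_direction_sub_le hN hF (hds k) _)).trans ?_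
    have := mul_le_mul_of_nonneg_left (norm_sq_le_weightedInner_self hp0 hp1
      ((mean fun i => X i k ω) - z)) (sq_nonneg (α k))
    simp only [V, U, γ]
    linarith
  have hrec : ∀ k ω, V (k + 1) ω = V k ω + ∑ l, 1 / p l * (b l k ω * W l k ω) := by
    intro k ω
    refine weightedInner_self_step p (fun l => hb.zero_or_one l k ω) fun l => ?_
    rw [PiLp.sub_apply, mean_step (F := F) (hds k) (v := fun i => X i k ω)
      (β := fun l => b l k ω) (α := α k) (fun i l => hX i k l ω) l, PiLp.sub_apply]
    abel
  have hInt : ∀ {f : Ω → ℝ}, Measurable f → (∃ C, ∀ ω ∈ S, |f ω| ≤ C) → IntegrableOn f S μ := by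
    rintro f hf ⟨C, hC⟩
    refine Measure.integrableOn_of_bounded (M := C) (measure_ne_top _ _) hf.aestronglyMeasurable ?_
    exact (ae_restrict_iff' (ℱ.le 0 _ hS)).2 (Eventually.of_forall hC)
  have hWb : ∀ l k, ∃ C, ∀ ω ∈ S, |W l k ω| ≤ C := fun l k =>
    ⟨2 * α k * ((R + k * B + ‖z‖) * B) + α k ^ 2 * B ^ 2, fun ω hω => by
      refine (abs_blockIncrement_le (hα0 k) _ _ l).trans ?_
      have h1 := hmeanb k ω hω
      have h2 := norm_direction_le (A := A k) hN hB fun i => X i k ω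
      have h3 := hα0 k
      have h4 : 0 ≤ R + k * B + ‖z‖ := (norm_nonneg _).trans h1
      gcongr⟩
  have hIV : ∀ k, IntegrableOn (V k) S μ := fun k => hInt ((hV k).mono (ℱ.le k) le_rfl)
    ⟨_, fun ω hω => by rw [abs_of_nonneg (hV0 k ω)]; exact hVb k ω hω⟩
  have hIW : ∀ l k, IntegrableOn (W l k) S μ := fun l k =>
    hInt ((hWm l k).mono (ℱ.le k) le_rfl) (hWb l k)
  have hIbW : ∀ l k, IntegrableOn (fun ω => b l k ω * W l k ω) S μ := fun l k => by
    obtain ⟨C, hC⟩ := hWb l k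
    refine hInt ((hb.measurable l k).mul ((hWm l k).mono (ℱ.le k) le_rfl)) ⟨C, fun ω hω => ?_⟩
    refine le_trans ?_ (hC ω hω)
    rcases hb.zero_or_one l k ω with h | h <;> simp [h]
  have hU0 : ∀ k ω, 0 ≤ U k ω := fun k ω => mul_nonneg (hα0 k) (sq_nonneg _)
  have hγ0 : ∀ k ω, 0 ≤ γ k ω := fun k ω => by positivity
  have hIU : ∀ k, IntegrableOn (U k) S μ := fun k => hInt ((hU k).mono (ℱ.le k) le_rfl)
    ⟨_, fun ω hω => by rw [abs_of_nonneg (hU0 k ω)]; exact hUb k ω hω⟩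
  have hIγ : ∀ k, IntegrableOn (γ k) S μ := fun k => hInt ((hγ k).mono (ℱ.le k) le_rfl)
    ⟨_, fun ω hω => by
      rw [abs_of_nonneg (hγ0 k ω)]
      exact (Finset.single_le_sum (f := fun j => γ j ω) (fun j _ => hγ0 j ω)
        (Finset.self_mem_range_succ k)).trans (hγb ω hω (k + 1))⟩
  refine ae_tendsto_and_summable_of_almost_supermartingale ℱ (β := fun k => α k ^ 2)
    hS hV hU hγ hV0 hU0 hγ0 (fun k => ⟨_, hVb k⟩) (fun k => ⟨_, hUb k⟩) ⟨_, hγb⟩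
    (fun k => sq_nonneg _) hα2 fun k s hs hsS => ?_
  have hIVs := (hIV k).mono_set hsS
  have hIWs : ∀ l, IntegrableOn (W l k) s μ := fun l => (hIW l k).mono_set hsS
  have hIbWs : ∀ l, IntegrableOn (fun ω => 1 / p l * (b l k ω * W l k ω)) s μ := fun l =>
    ((hIbW l k).mono_set hsS).const_mul _
  calc ∫ ω in s, V (k + 1) ω ∂μ
      = ∫ ω in s, V k ω ∂μ + ∑ l, ∫ ω in s, 1 / p l * (b l k ω * W l k ω) ∂μ := by
        simp_rw [hrec k]
        rw [integral_add hIVs (integrable_finsetSum _ fun l _ => hIbWs l),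
          integral_finsetSum _ fun l _ => hIbWs l]
    _ = ∫ ω in s, V k ω ∂μ + ∑ l, ∫ ω in s, W l k ω ∂μ := by
        congr 1
        refine Finset.sum_congr rfl fun l _ => ?_
        rw [integral_const_mul, setIntegral_mul_of_indep (ℱ.le k) (hb.measurable l k)
          (hb.indep_history l k) (hWm l k) hs, hb.integral_eq, ← mul_assoc,
          one_div_mul_cancel (hp0 l).ne', one_mul]
    _ = ∫ ω in s, (V k ω + ∑ l, W l k ω) ∂μ := by
        rw [integral_add hIVs (integrable_finsetSum _ fun l _ => hIWs l),
          integral_finsetSum _ fun l _ => hIWs l]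
    _ ≤ ∫ ω in s, ((1 + α k ^ 2) * V k ω - U k ω + γ k ω) ∂μ := by
        refine integral_mono (hIVs.add (integrable_finsetSum _ fun l _ => hIWs l))
          (((hIVs.const_mul _).sub ((hIU k).mono_set hsS)).add ((hIγ k).mono_set hsS)) fun ω => ?_
        have := hdrift k ω
        simp only
        linarith

end RandomIterates

lemma Stepsizes.summable_sq {α : ℕ → ℝ} (hα : Stepsizes α) : Summable fun k => α k ^ 2 := by
  rw [← summable_nat_add_iff 1]
  refine Summable.of_nonneg_of_le (fun k => sq_nonneg _) (fun k => ?_) hα.summable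
  rw [sq]
  exact mul_le_mul_of_nonneg_left (hα.antitone (Nat.div_le_self _ 2)) (hα.pos _).le

/-! ### Convergence along a single path -/

section Path

variable {N m : ℕ} {H : Fin m → Type*} [∀ l, NormedAddCommGroup (H l)]
  [∀ l, InnerProductSpace ℝ (H l)] [∀ l, CompleteSpace (H l)]
  {F : Fin N → PiLp 2 H → PiLp 2 H} {A : ℕ → Matrix (Fin N) (Fin N) ℝ} {α : ℕ → ℝ}

/-- A path whose disagreement vanishes, whose energies relative to a dense set of fixed points
converge and whose residuals satisfy `∑ α * r ^ 2 < ∞` is bounded and converges weakly. -/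
theorem weak_tendsto_of_energy_tendsto (hN : 0 < N) (hF : ∀ i, LipschitzWith 1 (F i)) {B : ℝ}
    (hB : ∀ i x, ‖F i x - x‖ ≤ B) (hA : ∀ k, A k ∈ doublyStochastic ℝ (Fin N))
    (hα : Stepsizes α) {p : Fin m → ℝ} (hp0 : ∀ l, 0 < p l) (hp1 : ∀ l, p l ≤ 1)
    {x : ℕ → Fin N → PiLp 2 H}
    (hstep : ∀ k i, ‖x (k + 1) i - ∑ j, A k i j • x k j‖ ≤ B * α k)
    (hdis : Tendsto (fun k => disagreement (x k)) atTop (𝓝 0))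
    {D : Set (PiLp 2 H)} (hD : Function.fixedPoints (globalOp F) ⊆ closure D)
    (hDne : D.Nonempty)
    (hV : ∀ z ∈ D, ∃ l,
      Tendsto (fun k => weightedInner p (mean (x k) - z) (mean (x k) - z)) atTop (𝓝 l))
    (hU : Summable fun k => α k * ‖globalOp F (mean (x k)) - mean (x k)‖ ^ 2) :
    (∃ C, ∀ i k, ‖x k i‖ ≤ C ∧ weightedNorm p (x k i) ≤ C) ∧
      ∃ y ∈ Function.fixedPoints (globalOp F), ∀ i,
        WeightedWeakTendsto p (fun k => x k i) y := by
  have hB0 : 0 ≤ B := (norm_nonneg _).trans (hB ⟨0, hN⟩ 0)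
  have hT := lipschitzWith_globalOp hN hF
  obtain ⟨C₁, hC₁⟩ : ∃ C, ∀ k, ‖mean (x k)‖ ≤ C := by
    obtain ⟨z, hz⟩ := hDne
    obtain ⟨l, hl⟩ := hV z hz
    obtain ⟨C, hC⟩ := hl.bddAbove_range
    refine ⟨√C + ‖z‖, fun k => ?_⟩
    have h1 : ‖mean (x k) - z‖ ≤ √C := Real.le_sqrt_of_sq_le
      ((norm_sq_le_weightedInner_self hp0 hp1 _).trans (hC ⟨k, rfl⟩))
    calc ‖mean (x k)‖ = ‖(mean (x k) - z) + z‖ := by rw [sub_add_cancel]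
      _ ≤ √C + ‖z‖ := (norm_add_le _ _).trans (by gcongr)
  obtain ⟨C₂, hC₂⟩ := hdis.bddAbove_range
  have hbdd : ∀ i k, ‖x k i‖ ≤ C₂ + C₁ := fun i k => by
    calc ‖x k i‖ = ‖(x k i - mean (x k)) + mean (x k)‖ := by rw [sub_add_cancel]
      _ ≤ C₂ + C₁ := (norm_add_le _ _).trans
        (add_le_add ((norm_sub_mean_le_disagreement _ i).trans (hC₂ ⟨k, rfl⟩)) (hC₁ k))
  refine ⟨⟨max (C₂ + C₁) (√(‖weightOp (H := H) p‖ * (C₂ + C₁) ^ 2)), fun i k =>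
    ⟨(hbdd i k).trans (le_max_left _ _), le_trans (Real.sqrt_le_sqrt ?_) (le_max_right _ _)⟩⟩, ?_⟩
  · exact (weightedInner_self_le p _).trans (by gcongr; exact hbdd i k)
  have hr : ∀ y, ‖globalOp F y - y‖ ≤ B := fun y => by
    rw [globalOp_sub_self hN]
    exact norm_mean_le hN fun i => hB i y
  have hmove : ∀ k, ‖mean (x (k + 1)) - mean (x k)‖ ≤ B * α k := fun k => by
    rw [← mean_mul (hA k) (x k), ← mean_sub]
    exact norm_mean_le hN (hstep k)
  have hres : Tendsto (fun k => ‖globalOp F (mean (x k)) - mean (x k)‖) atTop (𝓝 0) := by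
    refine tendsto_zero_of_summable_mul_sq (c := 2 * B) (fun k => norm_nonneg _)
      (fun k => hr _) (fun k => (hα.pos k).le) hα.le_one hα.summable_sq hα.sum_eq_top
      (by positivity) (fun k => ?_) hU
    have h1 : ‖globalOp F (mean (x (k + 1))) - globalOp F (mean (x k))‖ ≤
        ‖mean (x (k + 1)) - mean (x k)‖ := by
      simpa [dist_eq_norm] using hT.dist_le_mul (mean (x (k + 1))) (mean (x k))
    have h2 : globalOp F (mean (x (k + 1))) - mean (x (k + 1)) =
        (globalOp F (mean (x k)) - mean (x k)) +
        ((globalOp F (mean (x (k + 1))) - globalOp F (mean (x k))) -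
          (mean (x (k + 1)) - mean (x k))) := by abel
    rw [h2]
    refine (norm_add_le _ _).trans ?_
    have h3 := norm_sub_le (globalOp F (mean (x (k + 1))) - globalOp F (mean (x k)))
      (mean (x (k + 1)) - mean (x k))
    linarith [hmove k]
  obtain ⟨y, hy, hlim⟩ := exists_fixedPt_weak_limit hT (W := weightOp p)
    (fun y z => by rw [inner_weightOp_left, inner_weightOp_right])
    (fun y hy => by
      rw [inner_weightOp_left] at hy
      have := norm_sq_le_weightedInner_self hp0 hp1 y
      rw [hy] at this
      exact norm_eq_zero.1 (by nlinarith [norm_nonneg y])) hC₁ hres hD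
    (fun z hz => by simpa only [inner_weightOp_left] using hV z hz)
  refine ⟨y, hy, fun i u => ?_⟩
  simp only [← inner_weightOp_right]
  have hzero : Tendsto (fun k => inner ℝ (x k i - mean (x k)) (weightOp p u)) atTop (𝓝 0) := by
    refine squeeze_zero_norm (a := fun k => disagreement (x k) * ‖weightOp p u‖) (fun k => ?_)
      (by simpa using hdis.mul_const ‖weightOp p u‖)
    exact (norm_inner_le_norm _ _).trans (by
      gcongr
      exact norm_sub_mean_le_disagreement _ i)
  simpa [← inner_add_left] using hzero.add (hlim (weightOp p u))

end Path

end DBKM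

theorem theorem2 {N m : ℕ} (hN : 0 < N) (hm : 0 < m)
    -- the direct sum of separable real Hilbert spaces, with their Borel σ-algebras
    {H : Fin m → Type*} [∀ l, NormedAddCommGroup (H l)] [∀ l, InnerProductSpace ℝ (H l)]
    [∀ l, CompleteSpace (H l)] [∀ l, SecondCountableTopology (H l)]
    [∀ l, MeasurableSpace (H l)] [∀ l, BorelSpace (H l)]
    {Ω : Type*} [MeasurableSpace Ω] (μ : Measure Ω) [IsProbabilityMeasure μ]
    -- nonexpansive local operators whose average has a fixed point
    (F : Fin N → PiLp 2 H → PiLp 2 H) (hF : ∀ i, LipschitzWith 1 (F i))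
    (hfix : (Function.fixedPoints (DBKM.globalOp F)).Nonempty)
    (hbdd : DBKM.BoundedDisplacement F)
    -- communication graphs, weights and stepsizes
    (G : ℕ → Digraph (Fin N)) (A : ℕ → Matrix (Fin N) (Fin N) ℝ)
    (hA : DBKM.IsAdjacency G A) (hG : DBKM.UniformlyJointlyStronglyConnected G)
    (hW : DBKM.WeightsRule A)
    (α : ℕ → ℝ) (hα : DBKM.Stepsizes α)
    -- the random iteration
    (b : Fin m → ℕ → Ω → ℝ) (X : Fin N → ℕ → Ω → PiLp 2 H)
    (hX₀ : ∀ i, Measurable (X i 0))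
    (hb : DBKM.IsBlockSelection μ b X)
    (hX : DBKM.IsIteration A α b F X) :
    ∀ᵐ ω ∂μ,
      (∃ C : ℝ, ∀ i k, ‖X i k ω‖ ≤ C ∧ DBKM.weightedNorm (DBKM.blockProb μ b) (X i k ω) ≤ C) ∧
      ∃ x ∈ Function.fixedPoints (DBKM.globalOp F), ∀ i,
        DBKM.WeightedWeakTendsto (DBKM.blockProb μ b) (fun k => X i k ω) x := by
  obtain ⟨B, hB0, hB⟩ := hbdd
  have hα0 : ∀ k, 0 ≤ α k := fun k => (hα.pos k).le
  have hds := DBKM.mem_doublyStochastic_of_weightsRule hA hW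
  obtain ⟨D, hDsub, hDc, hD⟩ := TopologicalSpace.IsSeparable.exists_countable_dense_subset
    (TopologicalSpace.IsSeparable.of_separableSpace (Function.fixedPoints (DBKM.globalOp F)))
  have hDne : D.Nonempty := closure_nonempty_iff.1 (hfix.mono hD)
  have hae : ∀ᵐ ω ∂μ, ∀ z ∈ D, ∀ R : ℕ, _ := (ae_ball_iff hDc).2 fun z hz => ae_all_iff.2 fun R =>
    DBKM.ae_energy_tendsto (μ := μ) hN hF hB hA hG hW hα.antitone hα0 hα.le_one hα.summable_sq
      hX₀ hb hX (hDsub hz) (R : ℝ)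
  filter_upwards [hae] with ω hω
  obtain ⟨R, hR⟩ := exists_nat_ge (∑ i, ‖X i 0 ω‖)
  have hR' : ∀ i, ‖X i 0 ω‖ ≤ R := fun i =>
    (Finset.single_le_sum (f := fun i => ‖X i 0 ω‖) (fun _ _ => norm_nonneg _)
      (Finset.mem_univ i)).trans hR
  have hstep : ∀ k i, ‖X i (k + 1) ω - ∑ j, A k i j • X j k ω‖ ≤ B * α k := fun k i =>
    DBKM.norm_step_sub_aggregate_le (v := fun j => X j k ω) (v' := fun j => X j (k + 1) ω)
      (β := fun l => b l k ω) (hα0 k) (fun l => hb.zero_or_one l k ω) hB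
      (fun i l => hX i k l ω) i
  obtain ⟨K, hK⟩ := DBKM.exists_sum_disagreement_sq_le (E := PiLp 2 H) hN hA hG hW
    hα.antitone hα.summable_sq hB0.le (DBKM.disagreement fun i => X i 0 ω)
  have hdis : Tendsto (fun k => DBKM.disagreement fun i => X i k ω) atTop (𝓝 0) := by
    have h1 := (summable_of_sum_range_le (fun k => sq_nonneg _)
      (hK (fun k i => X i k ω) hstep le_rfl)).tendsto_atTop_zero.sqrt
    simpa [Real.sqrt_sq (DBKM.disagreement_nonneg _)] using h1
  obtain ⟨z, hz⟩ := hDne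
  exact DBKM.weak_tendsto_of_energy_tendsto (x := fun k i => X i k ω) hN hF hB hds hα hb.prob_pos
    (fun _ => measureReal_le_one) hstep hdis hD ⟨z, hz⟩ (fun z hz => (hω z hz R hR').1)
    (hω z hz R hR').2
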